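/- Let $\Bbbk$ be an algebraically closed field of characteristic $0$ and let $p\ge 1$. The level $p$ Yangian $\mathrm Y_p(\mathfrak{gl}_2)$ is the associative unital $\Bbbk$-algebra with generators $t_{ij}^{(1)},\dots,t_{ij}^{(p)}$, $i,j\in\{1,2\}$, and the defining relations $$[t^{(r)}_{ij}, t^{(s)}_{kl}] =\sum_{a=1}^{\min(r,s)} \big(t^{(a-1)}_{kj} t^{(r+s-a)}_{il}-t^{(r+s-a)}_{kj} t^{(a-1)}_{il}\big),\qquad 1\le r,s\le p,$$ where $t^{(0)}_{ij}=\delta_{ij}$ and $t^{(r)}_{ij}=0$ for $r\ge p+1$. Put $T_{ij}(u)=\delta_{ij}u^p+\sum_{k=1}^p t_{ij}^{(k)}u^{p-k}$ and $D(u)=T_{11}(u)T_{22}(u-1)-T_{21}(u)T_{12}(u-1)$. For $\ell=(\beta,\gamma)$ with $\beta\in\Bbbk^p$, $\gamma\in\Bbbk^{2p}$ put $\beta(u)=\prod_{i=1}^p(u+\beta_i)$, $\gamma(u)=\prod_{i=1}^{2p}(u+\gamma_i)$, let $I_\ell$ be the left ideal of $\mathrm Y_p(\mathfrak{gl}_2)$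 generated by the coefficients of the polynomials $T_{22}(u)-\beta(u)$ and $D(u)-\gamma(u)$, let $M(\ell)=\mathrm Y_p(\mathfrak{gl}_2)/I_\ell$, and let $\xi$ be the image of $1$ in $M(\ell)$. For $(k)=(k_1,\dots,k_p)\in\mathbb Z^p$ set $$\xi^{(k)}=\prod_{i,\ k_i>0}T_{21}(-\beta_i-k_i+1)\cdots T_{21}(-\beta_i-1)\,T_{21}(-\beta_i)\ \times\prod_{i,\ k_i<0}T_{12}(-\beta_i-k_i-1)\cdots T_{12}(-\beta_i+1)\,T_{12}(-\beta_i)\ \xi .$$ Let $\delta_i$ be the $i$-th standard basis vector of $\mathbb Z^p$. Theorem. Suppose that $\beta_i-\beta_j\notin\mathbb Z$ for all $i\ne j$. Then the vectors $\xi^{(k)}$, $(k)\in\mathbb Z^p$, form a basis of $M(\ell)$ over $\Bbbk$. Moreover, for all $(k)\in\mathbb Z^p$ the following identities of polynomials in $u$ with coefficients in $M(\ell)$ hold: $$T_{22}(u)\,\xi^{(k)}=\prod_{i=1}^p(u+\beta_i+k_i)\,\xi^{(k)},$$ $$T_{21}(u)\,\xi^{(k)}=\sum_{i=1}^p A_i(k)\,\prod_{j\ne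 i}\frac{u+\beta_j+k_j}{\beta_j-\beta_i+k_j-k_i}\ \xi^{(k+\delta_i)},\qquad T_{12}(u)\,\xi^{(k)}=\sum_{i=1}^p B_i(k)\,\prod_{j\ne i}\frac{u+\beta_j+k_j}{\beta_j-\beta_i+k_j-k_i}\ \xi^{(k-\delta_i)},$$ where $A_i(k)=1$ if $k_i\ge 0$ and $A_i(k)=-\gamma(-\beta_i-k_i)$ if $k_i<0$, while $B_i(k)=-\gamma(-\beta_i-k_i+1)$ if $k_i>0$ and $B_i(k)=1$ if $k_i\le 0$. Finally, $$\big(T_{11}(u)\,T_{22}(u-1)-T_{21}(u)\,T_{12}(u-1)\big)\,\xi^{(k)}=\gamma(u)\,\xi^{(k)}\qquad\text{for all }(k)\in\mathbb Z^p,$$ and this determines the action of $T_{11}(u)$: if $F(u)$ is a polynomial with coefficients in $\mathrm{End}_{\Bbbk}M(\ell)$ such that $\big(F(u)\,T_{22}(u-1)-T_{21}(u)\,T_{12}(u-1)\big)\,\xi^{(k)}=\gamma(u)\,\xi^{(k)}$ for all $(k)$, then $F(u)$ is the action of $T_{11}(u)$ on $M(\ell)$. -/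

import Mathlib

open Polynomial

noncomputable section

namespace LevelYangian

variable (K : Type*) [Field K] (p : ℕ)

/-- The symbol `t_{ij}^{(r)}` in the free algebra on the generators `t_{ij}^{(1)}, …, t_{ij}^{(p)}`
(the index `m : Fin p` stands for the superscript `m + 1`), with the conventions
`t_{ij}^{(0)} = δ_{ij}` and `t_{ij}^{(r)} = 0` for `r > p`.
The indices `1, 2` of `𝔤𝔩₂` are represented by `0, 1 : Fin 2`. -/
def freeGen (i j : Fin 2) : ℕ → FreeAlgebra K (Fin 2 × Fin 2 × Fin p)
  | 0 => if i = j then 1 else 0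
  | r + 1 => if h : r < p then FreeAlgebra.ι K (i, j, ⟨r, h⟩) else 0

/-- The defining relations of the level `p` Yangian:
`[t_{ij}^{(r)}, t_{kl}^{(s)}] =
  ∑_{a=1}^{min(r,s)} (t_{kj}^{(a-1)} t_{il}^{(r+s-a)} - t_{kj}^{(r+s-a)} t_{il}^{(a-1)})`. -/
inductive Rel : FreeAlgebra K (Fin 2 × Fin 2 × Fin p) →
    FreeAlgebra K (Fin 2 × Fin 2 × Fin p) → Prop
  | comm (i j k l : Fin 2) (r s : ℕ) (hr : r ∈ Finset.Icc 1 p) (hs : s ∈ Finset.Icc 1 p) :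
      Rel
        (freeGen K p i j r * freeGen K p k l s - freeGen K p k l s * freeGen K p i j r)
        (∑ a ∈ Finset.Icc 1 (min r s),
          (freeGen K p k j (a - 1) * freeGen K p i l (r + s - a)
            - freeGen K p k j (r + s - a) * freeGen K p i l (a - 1)))

/-- The level `p` Yangian `Y_p(𝔤𝔩₂)` over `K`. -/
def Yangian : Type _ := RingQuot (Rel K p)

instance : Ring (Yangian K p) := inferInstanceAs (Ring (RingQuot (Rel K p)))

instance : Algebra K (Yangian K p) := inferInstanceAs (Algebra K (RingQuot (Rel K p)))

/-- The element `t_{ij}^{(r)}` of the Yangian. -/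
def t (i j : Fin 2) (r : ℕ) : Yangian K p :=
  RingQuot.mkAlgHom K (Rel K p) (freeGen K p i j r)

/-- `T_{ij}(u) = δ_{ij} u^p + ∑_{k=1}^p t_{ij}^{(k)} u^{p-k}`. -/
def T (i j : Fin 2) : (Yangian K p)[X] :=
  (if i = j then X ^ p else 0) + ∑ k ∈ Finset.Icc 1 p, C (t K p i j k) * X ^ (p - k)

/-- `T_{11}(u)`. -/
abbrev T₁₁ : (Yangian K p)[X] := T K p 0 0

/-- `T_{12}(u)`. -/
abbrev T₁₂ : (Yangian K p)[X] := T K p 0 1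

/-- `T_{21}(u)`. -/
abbrev T₂₁ : (Yangian K p)[X] := T K p 1 0

/-- `T_{22}(u)`. -/
abbrev T₂₂ : (Yangian K p)[X] := T K p 1 1

/-- The quantum determinant `D(u) = T_{11}(u) T_{22}(u-1) - T_{21}(u) T_{12}(u-1)`. -/
def D : (Yangian K p)[X] :=
  T₁₁ K p * (T₂₂ K p).comp (X - 1) - T₂₁ K p * (T₁₂ K p).comp (X - 1)

variable {K} {p}

/-- The value of a polynomial with coefficients in the Yangian at a scalar. -/
def evalAt (P : (Yangian K p)[X]) (c : K) : Yangian K p :=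
  P.eval (algebraMap K (Yangian K p) c)

/-- The monic polynomial `(u + a_1) ⋯ (u + a_n)`. -/
def shiftPoly {n : ℕ} (a : Fin n → K) : K[X] := ∏ i, (X + C (a i))

/-- The left ideal `I_ℓ`, `ℓ = (β, γ)`, generated by the coefficients of `T_{22}(u) - β(u)` and
of `D(u) - γ(u)`. -/
def leftIdeal (β : Fin p → K) (γ : Fin (2 * p) → K) :
    Submodule (Yangian K p) (Yangian K p) :=
  Submodule.span (Yangian K p)
    (Set.range (fun n : ℕ =>
        (T₂₂ K p - (shiftPoly β).map (algebraMap K (Yangian K p))).coeff n) ∪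
      Set.range (fun n : ℕ =>
        (D K p - (shiftPoly γ).map (algebraMap K (Yangian K p))).coeff n))

/-- The universal module `M(ℓ) = Y_p(𝔤𝔩₂) / I_ℓ`. -/
abbrev UniversalModule (β : Fin p → K) (γ : Fin (2 * p) → K) : Type _ :=
  Yangian K p ⧸ leftIdeal β γ

/-- The product
`∏_{k_i > 0} T_{21}(-β_i-k_i+1) ⋯ T_{21}(-β_i-1) T_{21}(-β_i)
  × ∏_{k_i < 0} T_{12}(-β_i-k_i-1) ⋯ T_{12}(-β_i+1) T_{12}(-β_i)`.
The values of `T_{21}(u)` commute with each other, and so do those of `T_{12}(u)`; the factors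
are written here in the order of increasing `i`. -/
def tau (β : Fin p → K) (k : Fin p → ℤ) : Yangian K p :=
  (List.ofFn fun i : Fin p =>
      ((List.range (k i).toNat).reverse.map fun m : ℕ =>
        evalAt (T₂₁ K p) (-β i - (m : K))).prod).prod *
    (List.ofFn fun i : Fin p =>
      ((List.range (-k i).toNat).reverse.map fun m : ℕ =>
        evalAt (T₁₂ K p) (-β i + (m : K))).prod).prod

/-- The vector `ξ^{(k)}` of `M(ℓ)`: the above product applied to the image `ξ` of `1`. -/
def xi (β : Fin p → K) (γ : Fin (2 * p) → K) (k : Fin p → ℤ) : UniversalModule β γ :=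
  tau β k • Submodule.Quotient.mk (p := leftIdeal β γ) 1

/-- The coefficients `A_i(k)`. -/
def A (β : Fin p → K) (γ : Fin (2 * p) → K) (i : Fin p) (k : Fin p → ℤ) : K :=
  if 0 ≤ k i then 1 else -(shiftPoly γ).eval (-β i - (k i : K))

/-- The coefficients `B_i(k)`. -/
def B (β : Fin p → K) (γ : Fin (2 * p) → K) (i : Fin p) (k : Fin p → ℤ) : K :=
  if 0 < k i then -(shiftPoly γ).eval (-β i - (k i : K) + 1) else 1

/-- The interpolation polynomial
`∏_{j ≠ i} (u + β_j + k_j) / ∏_{j ≠ i} (β_j - β_i + k_j - k_i)`. -/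
def interp (β : Fin p → K) (i : Fin p) (k : Fin p → ℤ) : K[X] :=
  C (∏ j ∈ Finset.univ.erase i, (β j - β i + (k j : K) - (k i : K)))⁻¹ *
    ∏ j ∈ Finset.univ.erase i, (X + C (β j + (k j : K)))

/-- The polynomial with coefficients in `End_K M(ℓ)` through which a polynomial with coefficients
in the Yangian acts on `M(ℓ)`. -/
def act (β : Fin p → K) (γ : Fin (2 * p) → K) (P : (Yangian K p)[X]) :
    (Module.End K (UniversalModule β γ))[X] :=
  P.map (Algebra.lsmul K K (UniversalModule β γ)).toRingHom

end LevelYangian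

end

open LevelYangian

/-! On a vector where `T_{22}(u)` acts by a scalar polynomial with root `x`, the RTT relations force
`T_{21}(x)` to move that root to `x - 1` and `T_{12}(x)` to move it to `x + 1`. Starting from `ξ`,
every `ξ^{(k)}` is therefore an eigenvector of `T_{22}(u)`, and the `p` roots of its eigenvalue are
distinct because no `β_i - β_j` is an integer. Since `T_{21}(u)` and `T_{12}(u)` have degree below
`p`, Lagrange interpolation at these roots recovers them from their values there, and each value
shifts one label up to a scalar. A shift away from label `0` has scalar `1` by construction. For a
shift back towards `0`, the quantum determinant, which acts by `γ(u)` on every `ξ^{(k)}`, is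
evaluated where one of its two products vanishes; the other product is then `γ`.

Spanning: the span of the `ξ^{(k)}` is stable under `T_{22}`, `T_{21}`, `T_{12}` by these formulas,
and under `T_{11}` because the determinant expresses `T_{11}(u) T_{22}(u-1)` through the others and
the eigenvalue of `T_{22}(u-1)` can be divided out for all but finitely many `u`. The same division
shows that the determinant relation determines `T_{11}`.

Independence: the formulas are realised on a space with basis `ℤ^p`, with `T_{11}(u)` defined as
`T_{22}(u) - [t_{21}^{(1)}, T_{12}(u)]`. The relations without `T_{11}` on the left are direct
computations. The determinant relation holds because its defect has degree below `2p` and kills each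
basis vector at `2p` distinct points (`opEval_detDefect_eq_zero`). The relations involving `T_{11}`
then follow formally, the determinant being scalar and the monic `T_{22}(u-1)` cancellable
(`isRTT_of_quantumDet`). The resulting map from `M(ℓ)` sends the `ξ^{(k)}` to a basis.

Relations are handled through values at scalars; a polynomial identity valid outside finitely many
scalars holds for all coefficients. -/

namespace LevelYangian

/-! ### Polynomials over a noncommutative algebra, their values at scalars, and interpolation. -/

section Evaluation

variable {K R N : Type*} [Field K] [Ring R] [Algebra K R]

/-- Evaluation of a polynomial with coefficients in a `K`-algebra at a scalar. -/
noncomputable def evalScalar (u : K) : R[X] →+* R :=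
  eval₂RingHom' (RingHom.id R) (algebraMap K R u) fun a => (Algebra.commutes u a).symm

theorem evalScalar_apply (u : K) (P : R[X]) : evalScalar u P = P.eval (algebraMap K R u) := rfl

@[simp] theorem evalScalar_C (u : K) (x : R) : evalScalar u (C x) = x := by
  simp [evalScalar_apply]

@[simp] theorem evalScalar_X (u : K) : evalScalar u (X : R[X]) = algebraMap K R u := by
  simp [evalScalar_apply]

@[simp] theorem evalScalar_map (u : K) (q : K[X]) :
    evalScalar u (q.map (algebraMap K R)) = algebraMap K R (q.eval u) := by
  rw [evalScalar_apply, eval_map, eval₂_at_apply]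

theorem evalScalar_comp_X_sub_one (u : K) (P : R[X]) :
    evalScalar u (P.comp (X - 1)) = evalScalar (u - 1) P := by
  induction P using Polynomial.induction_on' with
  | add P Q hP hQ => simp [hP, hQ]
  | monomial n x =>
    rw [← C_mul_X_pow_eq_monomial]
    have h : (C x * X ^ n : R[X]).comp (X - 1) = C x * (X - 1) ^ n := by
      rw [C_mul_comp, X_pow_comp]
    rw [h]
    simp [map_mul, map_pow]

theorem evalScalar_eq_sum (u : K) (P : R[X]) :
    evalScalar u P = ∑ n ∈ P.support, u ^ n • P.coeff n := by
  rw [evalScalar_apply, eval_eq_sum, Polynomial.sum]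
  refine Finset.sum_congr rfl fun n _ => ?_
  rw [← map_pow, ← Algebra.commutes, Algebra.smul_def]

variable [AddCommGroup N] [Module K N] [Module R N] [IsScalarTower K R N]

/-- A linear functional turns a polynomial with coefficients in an algebra, applied to a vector,
into a polynomial with scalar coefficients. -/
theorem exists_scalar_polynomial (L : N →ₗ[K] K) (η : N) (P : R[X]) :
    ∃ g : K[X], (∀ n, g.coeff n = L (P.coeff n • η)) ∧
      ∀ u, g.eval u = L (evalScalar u P • η) := by
  refine ⟨∑ n ∈ P.support, C (L (P.coeff n • η)) * X ^ n, fun n => ?_, fun u => ?_⟩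
  · simp only [finsetSum_coeff, coeff_C_mul_X_pow]
    rw [Finset.sum_ite_eq]
    split_ifs with h
    · rfl
    · simp [notMem_support_iff.1 h]
  · rw [eval_finsetSum, evalScalar_eq_sum, Finset.sum_smul, map_sum]
    refine Finset.sum_congr rfl fun n _ => ?_
    rw [smul_assoc, LinearMap.map_smul]
    rw [eval_C_mul, eval_X_pow, smul_eq_mul, mul_comm]

/-- Linear functionals on `N ⧸ W` separate points and turn the claim into one about a scalar
polynomial with infinitely many roots. The finite set `S` leaves room for points where a division is
impossible. -/
theorem coeff_smul_mem [Infinite K] {P : R[X]} {η : N} {W : Submodule K N} {S : Set K}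
    (hS : S.Finite) (h : ∀ u ∉ S, evalScalar u P • η ∈ W) (n : ℕ) : P.coeff n • η ∈ W := by
  rw [← Submodule.Quotient.mk_eq_zero, ← Module.forall_dual_apply_eq_zero_iff K]
  intro f
  obtain ⟨g, hg, hge⟩ := exists_scalar_polynomial (f.comp W.mkQ) η P
  have h0 : g = 0 := by
    refine eq_zero_of_infinite_isRoot g (Set.Infinite.mono ?_ hS.infinite_compl)
    intro u hu
    have := (Submodule.Quotient.mk_eq_zero W).2 (h u hu)
    simp [IsRoot, hge, this]
  have := hg n
  rw [h0, coeff_zero] at this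
  simpa using this.symm

theorem coeff_smul_eq [Infinite K] {P Q : R[X]} {η ζ : N} {S : Set K}
    (hS : S.Finite) (h : ∀ u ∉ S, evalScalar u P • η = evalScalar u Q • ζ) (n : ℕ) :
    P.coeff n • η = Q.coeff n • ζ := by
  rw [← sub_eq_zero, ← Module.forall_dual_apply_eq_zero_iff K]
  intro f
  obtain ⟨g, hg, hge⟩ := exists_scalar_polynomial f η P
  obtain ⟨g', hg', hge'⟩ := exists_scalar_polynomial f ζ Q
  have h0 : g - g' = 0 := by
    refine eq_zero_of_infinite_isRoot _ (Set.Infinite.mono ?_ hS.infinite_compl)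
    intro u hu
    simp [IsRoot, hge, hge', h u hu]
  rw [map_sub, ← hg, ← hg', ← coeff_sub, h0, coeff_zero]

theorem evalScalar_smul_eq_of_coeff {P Q : R[X]} {η ζ : N}
    (h : ∀ n, P.coeff n • η = Q.coeff n • ζ) (u : K) :
    evalScalar u P • η = evalScalar u Q • ζ := by
  rw [← sub_eq_zero, ← Module.forall_dual_apply_eq_zero_iff K]
  intro f
  obtain ⟨g, hg, hge⟩ := exists_scalar_polynomial f η P
  obtain ⟨g', hg', hge'⟩ := exists_scalar_polynomial f ζ Q
  have : g = g' := by
    ext n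
    rw [hg, hg', h]
  rw [map_sub, ← hge, ← hge', this, sub_self]

/-- Restores the exceptional values, typically `u = v`, lost when a factor `u - v` is cancelled in
an RTT relation. -/
theorem evalScalar_smul_eq [Infinite K] {P Q : R[X]} {η ζ : N} {S : Set K}
    (hS : S.Finite) (h : ∀ u ∉ S, evalScalar u P • η = evalScalar u Q • ζ) (u : K) :
    evalScalar u P • η = evalScalar u Q • ζ :=
  evalScalar_smul_eq_of_coeff (coeff_smul_eq hS h) u

theorem eq_of_evalScalar [Infinite K] {P Q : R[X]}
    (h : ∀ u : K, evalScalar u P = evalScalar u Q) : P = Q := by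
  ext n
  have := coeff_smul_eq (K := K) (N := R) (η := 1) (ζ := 1) (P := P) (Q := Q) Set.finite_empty
    (fun u _ => by rw [h]) n
  simpa using this

/-- Lagrange interpolation for a polynomial with coefficients in an algebra, applied to a
vector. -/
theorem coeff_smul_eq_sum_basis {ι : Type*} [Fintype ι] [DecidableEq ι] {x : ι → K}
    (hx : Function.Injective x) {P : R[X]} (hP : P.degree < Fintype.card ι) (η : N) (n : ℕ) :
    P.coeff n • η
      = ∑ i, (Lagrange.basis Finset.univ x i).coeff n • evalScalar (x i) P • η := by
  rw [← sub_eq_zero, ← Module.forall_dual_apply_eq_zero_iff K]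
  intro f
  obtain ⟨g, hg, hge⟩ := exists_scalar_polynomial f η P
  have hdeg : g.degree < (Finset.univ : Finset ι).card := by
    rw [Finset.card_univ, degree_lt_iff_coeff_zero]
    intro m hm
    rw [hg, (degree_lt_iff_coeff_zero P _).1 hP m hm, zero_smul, map_zero]
  have h := Lagrange.eq_interpolate (s := Finset.univ) (v := x) hx.injOn hdeg
  rw [map_sub, ← hg, map_sum, sub_eq_zero]
  conv_lhs => rw [h]
  rw [Lagrange.interpolate_apply, finsetSum_coeff]
  refine Finset.sum_congr rfl fun i _ => ?_
  rw [coeff_C_mul, hge, LinearMap.map_smul f, smul_eq_mul, mul_comm]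

theorem evalScalar_smul_eq_sum_basis {ι : Type*} [Fintype ι] [DecidableEq ι] {x : ι → K}
    (hx : Function.Injective x) {P : R[X]} (hP : P.degree < Fintype.card ι) (η : N) (u : K) :
    evalScalar u P • η
      = ∑ i, (Lagrange.basis Finset.univ x i).eval u • evalScalar (x i) P • η := by
  rw [← sub_eq_zero, ← Module.forall_dual_apply_eq_zero_iff K]
  intro f
  obtain ⟨g, hg, hge⟩ := exists_scalar_polynomial f η P
  have hdeg : g.degree < (Finset.univ : Finset ι).card := by
    rw [Finset.card_univ, degree_lt_iff_coeff_zero]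
    intro m hm
    rw [hg, (degree_lt_iff_coeff_zero P _).1 hP m hm, zero_smul, map_zero]
  have h := Lagrange.eq_interpolate (s := Finset.univ) (v := x) hx.injOn hdeg
  rw [map_sub, ← hge, map_sum, sub_eq_zero]
  conv_lhs => rw [h]
  rw [Lagrange.interpolate_apply, eval_finsetSum]
  refine Finset.sum_congr rfl fun i _ => ?_
  rw [eval_C_mul, hge, LinearMap.map_smul f, smul_eq_mul, mul_comm]

end Evaluation

/-! ### Equivalence of three forms of the defining relations: commutators, differences, generating
polynomials. -/

section RTT

variable {K R : Type*} [Field K] [Ring R] [Algebra K R]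

/-- The `RTT` relations, for the values at scalars of a `2 × 2` matrix of polynomials:
`(u - v) [T_{ij}(u), T_{kl}(v)] = T_{kj}(u) T_{il}(v) - T_{kj}(v) T_{il}(u)`. -/
def IsRTT (T : Fin 2 → Fin 2 → K → R) : Prop :=
  ∀ i j k l u v, (u - v) • (T i j u * T k l v - T k l v * T i j u)
    = T k j u * T i l v - T k j v * T i l u

theorem sum_range_mul_sum_range (p : ℕ) (f g : ℕ → R) (u v : K) :
    (∑ r ∈ Finset.range (p + 1), u ^ (p - r) • f r)
        * (∑ s ∈ Finset.range (p + 1), v ^ (p - s) • g s)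
      = ∑ r ∈ Finset.range (p + 1), ∑ s ∈ Finset.range (p + 1),
        (u ^ (p - r) * v ^ (p - s)) • (f r * g s) := by
  rw [Finset.sum_mul_sum]
  refine Finset.sum_congr rfl fun r _ => Finset.sum_congr rfl fun s _ => ?_
  rw [smul_mul_smul_comm]

/-- Multiplication by `u` shifts the index by one; the two boundary terms that would not match are
`f 0` and `f (p + 1)`. -/
theorem smul_sum_range {M : Type*} [AddCommGroup M] [Module K M] (p : ℕ) (f : ℕ → M)
    (h0 : f 0 = 0) (hp : f (p + 1) = 0) (u : K) :
    u • ∑ r ∈ Finset.range (p + 1), u ^ (p - r) • f r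
      = ∑ r ∈ Finset.range (p + 1), u ^ (p - r) • f (r + 1) := by
  rw [Finset.sum_range_succ', Finset.sum_range_succ _ p, h0, hp, smul_zero, smul_zero, add_zero,
    add_zero, Finset.smul_sum]
  refine Finset.sum_congr rfl fun r hr => ?_
  have : p - r = (p - (r + 1)) + 1 := by have := Finset.mem_range.1 hr; omega
  rw [smul_smul, this, pow_succ']

/-- The commutator of two generating polynomials, multiplied by `u - v`. -/
theorem sub_smul_commutator_sum (p : ℕ) (f g : ℕ → R)
    (hf0 : ∀ s, f 0 * g s = g s * f 0) (hg0 : ∀ r, f r * g 0 = g 0 * f r)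
    (hf : f (p + 1) = 0) (hg : g (p + 1) = 0) (u v : K) :
    (u - v) • ((∑ r ∈ Finset.range (p + 1), u ^ (p - r) • f r)
          * (∑ s ∈ Finset.range (p + 1), v ^ (p - s) • g s)
        - (∑ s ∈ Finset.range (p + 1), v ^ (p - s) • g s)
          * (∑ r ∈ Finset.range (p + 1), u ^ (p - r) • f r))
      = ∑ r ∈ Finset.range (p + 1), ∑ s ∈ Finset.range (p + 1),
        (u ^ (p - r) * v ^ (p - s)) • ((f (r + 1) * g s - g s * f (r + 1))
          - (f r * g (s + 1) - g (s + 1) * f r)) := by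
  have key : (∑ r ∈ Finset.range (p + 1), u ^ (p - r) • f r)
          * (∑ s ∈ Finset.range (p + 1), v ^ (p - s) • g s)
        - (∑ s ∈ Finset.range (p + 1), v ^ (p - s) • g s)
          * (∑ r ∈ Finset.range (p + 1), u ^ (p - r) • f r)
      = ∑ r ∈ Finset.range (p + 1), ∑ s ∈ Finset.range (p + 1),
        (u ^ (p - r) * v ^ (p - s)) • (f r * g s - g s * f r) := by
    rw [sum_range_mul_sum_range, sum_range_mul_sum_range, Finset.sum_comm (f := fun s r =>
      (v ^ (p - s) * u ^ (p - r)) • (g s * f r)), ← Finset.sum_sub_distrib]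
    refine Finset.sum_congr rfl fun r _ => ?_
    rw [← Finset.sum_sub_distrib]
    refine Finset.sum_congr rfl fun s _ => ?_
    rw [smul_sub, mul_comm (v ^ _)]
  have h1 : u • ∑ r ∈ Finset.range (p + 1), ∑ s ∈ Finset.range (p + 1),
        (u ^ (p - r) * v ^ (p - s)) • (f r * g s - g s * f r)
      = ∑ r ∈ Finset.range (p + 1), ∑ s ∈ Finset.range (p + 1),
        (u ^ (p - r) * v ^ (p - s)) • (f (r + 1) * g s - g s * f (r + 1)) := by
    simp only [mul_smul, ← Finset.smul_sum]
    exact smul_sum_range p (fun r => ∑ s ∈ Finset.range (p + 1),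
      v ^ (p - s) • (f r * g s - g s * f r)) (by simp [hf0]) (by simp [hf]) u
  have h2 : v • ∑ r ∈ Finset.range (p + 1), ∑ s ∈ Finset.range (p + 1),
        (u ^ (p - r) * v ^ (p - s)) • (f r * g s - g s * f r)
      = ∑ r ∈ Finset.range (p + 1), ∑ s ∈ Finset.range (p + 1),
        (u ^ (p - r) * v ^ (p - s)) • (f r * g (s + 1) - g (s + 1) * f r) := by
    rw [Finset.smul_sum]
    refine Finset.sum_congr rfl fun r _ => ?_
    simp only [mul_smul, ← Finset.smul_sum]
    rw [smul_comm]
    congr 1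
    exact smul_sum_range p (fun s => f r * g s - g s * f r) (by simp [hg0]) (by simp [hg]) v
  rw [key, sub_smul, h1, h2, ← Finset.sum_sub_distrib]
  refine Finset.sum_congr rfl fun r _ => ?_
  rw [← Finset.sum_sub_distrib]
  refine Finset.sum_congr rfl fun s _ => ?_
  rw [smul_sub _ (_ - _)]

/-- The difference form of the defining relations of the Yangian. -/
def IsDifferenceRTT (t : Fin 2 → Fin 2 → ℕ → R) : Prop :=
  ∀ i j k l r s, (t i j (r + 1) * t k l s - t k l s * t i j (r + 1))
      - (t i j r * t k l (s + 1) - t k l (s + 1) * t i j r)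
    = t k j r * t i l s - t k j s * t i l r

/-- The generating polynomial `∑ t^{(r)} u^{p-r}`, evaluated at a scalar. -/
def genSum (p : ℕ) (t : Fin 2 → Fin 2 → ℕ → R) (i j : Fin 2) (u : K) : R :=
  ∑ r ∈ Finset.range (p + 1), u ^ (p - r) • t i j r

/-- The defect of the RTT relation is the generating polynomial of the defects of the difference
relations, so this one identity gives the passage in both directions. -/
theorem genSum_sub (p : ℕ) (t : Fin 2 → Fin 2 → ℕ → R) (h0 : ∀ i j x, t i j 0 * x = x * t i j 0)
    (hp : ∀ i j, t i j (p + 1) = 0) (i j k l : Fin 2) (u v : K) :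
    (u - v) • (genSum p t i j u * genSum p t k l v - genSum p t k l v * genSum p t i j u)
        - (genSum p t k j u * genSum p t i l v - genSum p t k j v * genSum p t i l u)
      = ∑ r ∈ Finset.range (p + 1), ∑ s ∈ Finset.range (p + 1),
        (u ^ (p - r) * v ^ (p - s)) • (((t i j (r + 1) * t k l s - t k l s * t i j (r + 1))
          - (t i j r * t k l (s + 1) - t k l (s + 1) * t i j r))
          - (t k j r * t i l s - t k j s * t i l r)) := by
  unfold genSum
  rw [sub_smul_commutator_sum p _ _ (fun s => h0 _ _ _) (fun r => (h0 _ _ _).symm) (hp _ _)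
    (hp _ _), sum_range_mul_sum_range, sum_range_mul_sum_range,
    Finset.sum_comm (f := fun s r => (v ^ (p - s) * u ^ (p - r)) • (t k j s * t i l r)),
    ← Finset.sum_sub_distrib, ← Finset.sum_sub_distrib]
  refine Finset.sum_congr rfl fun r _ => ?_
  rw [← Finset.sum_sub_distrib, ← Finset.sum_sub_distrib]
  refine Finset.sum_congr rfl fun s _ => ?_
  rw [mul_comm (v ^ _), ← smul_sub, ← smul_sub]

theorem IsDifferenceRTT.isRTT {p : ℕ} {t : Fin 2 → Fin 2 → ℕ → R} (h : IsDifferenceRTT t)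
    (h0 : ∀ i j x, t i j 0 * x = x * t i j 0) (hp : ∀ i j, t i j (p + 1) = 0) :
    IsRTT (K := K) (genSum p t) := by
  intro i j k l u v
  rw [← sub_eq_zero, genSum_sub p t h0 hp]
  refine Finset.sum_eq_zero fun r _ => Finset.sum_eq_zero fun s _ => ?_
  rw [h, sub_self, smul_zero]

theorem eq_zero_of_sum_pow_smul [Infinite K] (p : ℕ) (m : ℕ → R)
    (h : ∀ u : K, ∑ r ∈ Finset.range (p + 1), u ^ (p - r) • m r = 0) (r : ℕ) (hr : r ≤ p) :
    m r = 0 := by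
  have hP : (∑ r ∈ Finset.range (p + 1), C (m r) * X ^ (p - r) : R[X]) = 0 := by
    refine eq_of_evalScalar (K := K) fun u => ?_
    rw [map_zero, ← h u, map_sum]
    refine Finset.sum_congr rfl fun r _ => ?_
    rw [map_mul, map_pow, evalScalar_C, evalScalar_X, ← map_pow, ← Algebra.commutes,
      Algebra.smul_def]
  have := congrArg (fun P : R[X] => P.coeff (p - r)) hP
  simp only [finsetSum_coeff, coeff_C_mul_X_pow, coeff_zero] at this
  rw [Finset.sum_eq_single r] at this
  · simpa using this
  · intro s hs hne
    have := Finset.mem_range.1 hs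
    rw [if_neg (by omega)]
  · intro hr'
    exact absurd (Finset.mem_range.2 (by omega)) hr'

theorem IsRTT.isDifferenceRTT [Infinite K] {p : ℕ} {t : Fin 2 → Fin 2 → ℕ → R}
    (h : IsRTT (K := K) (genSum p t))
    (h0 : ∀ i j x, t i j 0 * x = x * t i j 0) (hp : ∀ i j r, p < r → t i j r = 0) :
    IsDifferenceRTT t := by
  intro i j k l r s
  by_cases hr : p < r
  · simp [hp _ _ _ hr, hp _ _ _ (Nat.lt_succ_of_lt hr)]
  by_cases hs : p < s
  · simp [hp _ _ _ hs, hp _ _ _ (Nat.lt_succ_of_lt hs)]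
  rw [← sub_eq_zero]
  refine eq_zero_of_sum_pow_smul (K := K) p (fun s => ((t i j (r + 1) * t k l s
    - t k l s * t i j (r + 1)) - (t i j r * t k l (s + 1) - t k l (s + 1) * t i j r))
          - (t k j r * t i l s - t k j s * t i l r)) (fun v => ?_) s (by omega)
  refine eq_zero_of_sum_pow_smul (K := K) p (fun r => ∑ s ∈ Finset.range (p + 1), v ^ (p - s) •
    (((t i j (r + 1) * t k l s
    - t k l s * t i j (r + 1)) - (t i j r * t k l (s + 1) - t k l (s + 1) * t i j r))
          - (t k j r * t i l s - t k j s * t i l r))) (fun u => ?_) r (by omega)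
  have := genSum_sub p t h0 (fun i j => hp i j _ (Nat.lt_succ_self p)) i j k l u v
  rw [h, sub_self] at this
  rw [this]
  refine Finset.sum_congr rfl fun r _ => ?_
  rw [Finset.smul_sum]
  refine Finset.sum_congr rfl fun s _ => ?_
  rw [smul_smul]

/-- The defining relations of the Yangian, for a family of elements of a ring. -/
def IsCommutatorRTT (t : Fin 2 → Fin 2 → ℕ → R) : Prop :=
  ∀ i j k l r s, t i j r * t k l s - t k l s * t i j r
    = ∑ a ∈ Finset.range (min r s),
      (t k j a * t i l (r + s - (a + 1)) - t k j (r + s - (a + 1)) * t i l a)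

/-- Both commutators have total degree `r + s + 1`, so their sums have the same terms and differ
only in the upper limit. The difference is at most one term, and is empty when `r = s`. -/
theorem IsCommutatorRTT.isDifferenceRTT {t : Fin 2 → Fin 2 → ℕ → R} (h : IsCommutatorRTT t) :
    IsDifferenceRTT t := by
  intro i j k l r s
  rw [h, h]
  have e1 : r + 1 + s = r + s + 1 := by omega
  have e2 : r + (s + 1) = r + s + 1 := by omega
  rw [e1, e2]
  rcases lt_trichotomy r s with hrs | rfl | hrs
  · rw [min_eq_left (by omega), min_eq_left (by omega), Finset.sum_range_succ, add_sub_cancel_left]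
    congr 3 <;> omega
  · rw [min_eq_right (by omega), min_eq_left (by omega)]
    simp
  · rw [min_eq_right (by omega), min_eq_right (by omega), Finset.sum_range_succ,
      sub_add_cancel_left, neg_sub]
    have : r + s + 1 - (s + 1) = r := by omega
    rw [this]

/-- The difference relations telescope down to a commutator with a central element of index `0`.
Descending in `r` gives a sum of length `r`, descending in `s` one of length `s`; the shorter is
chosen. -/
theorem IsDifferenceRTT.isCommutatorRTT {t : Fin 2 → Fin 2 → ℕ → R} (h : IsDifferenceRTT t)
    (h0 : ∀ i j x, t i j 0 * x = x * t i j 0) : IsCommutatorRTT t := by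
  have left : ∀ i j k l r s, t i j r * t k l s - t k l s * t i j r
      = ∑ a ∈ Finset.range r,
      (t k j a * t i l (r + s - (a + 1)) - t k j (r + s - (a + 1)) * t i l a) := by
    intro i j k l r
    induction r with
    | zero => intro s; simp [h0]
    | succ r ih =>
      intro s
      have e : r + (s + 1) = r + 1 + s := by omega
      have e' : r + 1 + s - (r + 1) = s := by omega
      rw [Finset.sum_range_succ, e', ← e, ← ih, ← h i j k l r s]
      abel
  have right : ∀ i j k l s r, t i j r * t k l s - t k l s * t i j r
      = ∑ a ∈ Finset.range s,
      (t k j a * t i l (r + s - (a + 1)) - t k j (r + s - (a + 1)) * t i l a) := by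
    intro i j k l s
    induction s with
    | zero => intro r; simp [h0]
    | succ s ih =>
      intro r
      have e : r + 1 + s = r + (s + 1) := by omega
      have e' : r + (s + 1) - (s + 1) = r := by omega
      have := h i j k l r s
      rw [Finset.sum_range_succ, e', ← e, ← ih, ← neg_sub (t k j r * t i l s),
        ← h i j k l r s]
      abel
  intro i j k l r s
  rcases le_total r s with hrs | hrs
  · rw [min_eq_left hrs, left]
  · rw [min_eq_right hrs, right]

end RTT

/-! ### The RTT relations in the level `p` Yangian. -/

section Yangian

variable {K : Type*} [Field K] {p : ℕ}

theorem t_zero (i j : Fin 2) : t K p i j 0 = if i = j then 1 else 0 := by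
  unfold t freeGen
  split_ifs
  · exact map_one _
  · exact map_zero _

theorem t_of_lt (i j : Fin 2) {r : ℕ} (hr : p < r) : t K p i j r = 0 := by
  obtain ⟨r, rfl⟩ : ∃ s, r = s + 1 := ⟨r - 1, by omega⟩
  unfold t freeGen
  simp only
  rw [dif_neg (by omega)]
  exact map_zero _

theorem t_zero_commute (i j : Fin 2) (x : Yangian K p) : t K p i j 0 * x = x * t K p i j 0 := by
  rw [t_zero]
  split_ifs <;> simp

theorem sum_Icc_one_eq_sum_range {M : Type*} [AddCommMonoid M] (n : ℕ) (f : ℕ → M) :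
    ∑ a ∈ Finset.Icc 1 n, f a = ∑ a ∈ Finset.range n, f (a + 1) := by
  rw [Finset.range_eq_Ico, Finset.sum_Ico_add' f 0 n 1]
  rfl

/-- The relations extend to all superscripts: if `r` or `s` exceeds `p`, each term on the right
contains a generator of superscript `r + s - (a + 1) ≥ max r s > p`, which is zero. -/
theorem isCommutatorRTT_t : IsCommutatorRTT (t K p) := by
  intro i j k l r s
  rcases Nat.eq_zero_or_pos r with rfl | hr
  · simp [t_zero_commute]
  rcases Nat.eq_zero_or_pos s with rfl | hs
  · simp [t_zero_commute]
  by_cases hr' : p < r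
  · rw [t_of_lt i j hr', Finset.sum_eq_zero]
    · simp
    · intro a ha
      have := Finset.mem_range.1 ha
      rw [t_of_lt i l (r := r + s - (a + 1)) (by omega),
        t_of_lt k j (r := r + s - (a + 1)) (by omega), mul_zero, zero_mul, sub_zero]
  by_cases hs' : p < s
  · rw [t_of_lt k l hs', Finset.sum_eq_zero]
    · simp
    · intro a ha
      have := Finset.mem_range.1 ha
      rw [t_of_lt i l (r := r + s - (a + 1)) (by omega),
        t_of_lt k j (r := r + s - (a + 1)) (by omega), mul_zero, zero_mul, sub_zero]
  have h := RingQuot.mkAlgHom_rel K (Rel.comm (K := K) (p := p) i j k l r s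
    (Finset.mem_Icc.2 ⟨hr, by omega⟩) (Finset.mem_Icc.2 ⟨hs, by omega⟩))
  rw [sum_Icc_one_eq_sum_range] at h
  simp only [map_sub, map_mul, map_sum, Nat.add_sub_cancel] at h
  exact h

theorem evalScalar_T (i j : Fin 2) (u : K) :
    evalScalar u (T K p i j) = genSum p (t K p) i j u := by
  unfold T genSum
  rw [map_add, map_sum, sum_Icc_one_eq_sum_range, Finset.sum_range_succ', add_comm]
  congr 1
  · refine Finset.sum_congr rfl fun r _ => ?_
    rw [map_mul, map_pow, evalScalar_C, evalScalar_X, ← map_pow, ← Algebra.commutes,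
      Algebra.smul_def]
  · rw [t_zero]
    split_ifs
    · rw [map_pow, evalScalar_X, Nat.sub_zero, Algebra.smul_def, mul_one, map_pow]
    · simp

theorem isRTT_yangian : IsRTT (K := K) fun i j u => evalScalar u (T K p i j) := by
  simp only [evalScalar_T]
  exact isCommutatorRTT_t.isDifferenceRTT.isRTT t_zero_commute
    fun i j => t_of_lt i j (Nat.lt_succ_self p)

theorem evalAt_eq_evalScalar (P : (Yangian K p)[X]) (u : K) : evalAt P u = evalScalar u P := rfl

end Yangian

/-! ### Identities relating commutators with the quantum determinant to the RTT defects. -/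

section QuantumDeterminant

variable {K R : Type*} [Field K] [Ring R] [Algebra K R] {a b c d : K → R}

/-- Commuting a quantum determinant with the lower left entry. -/
theorem lower_identity
    (hcd : ∀ u v, (u - v) • (c u * d v - d v * c u) = c u * d v - c v * d u)
    (hcc : ∀ u v, c u * c v = c v * c u) (u v : K) :
    d (u - 1) * ((u - v) • (a u * c v - c v * a u) - (c u * a v - c v * a u))
      = (u - v) • ((d (u - 1) * a u - c (u - 1) * b u) * c v
          - c v * (d (u - 1) * a u - c (u - 1) * b u))
        + c (u - 1) * ((u - v) • (b u * c v - c v * b u) - (d u * a v - d v * a u)) := by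
  have h1 := congrArg (· * a u) (hcd v (u - 1))
  have h2 := congrArg (· * a v) (hcd u (u - 1))
  have h3 := congrArg (· * b u) (hcc v (u - 1))
  simp only [mul_sub, sub_mul, smul_mul_assoc, mul_smul_comm, mul_assoc, smul_sub] at h1 h2 h3 ⊢
  linear_combination (norm := module) h2 - h1 - (u - v) • h3

/-- Commuting a quantum determinant with the upper right entry. -/
theorem upper_identity
    (hbd : ∀ u v, (u - v) • (b u * d v - d v * b u) = d u * b v - d v * b u)
    (hbb : ∀ u v, b u * b v = b v * b u) (u v : K) :
    ((u - v) • (a u * b v - b v * a u) - (a u * b v - a v * b u)) * d (u - 1)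
      = (u - v) • ((a u * d (u - 1) - c u * b (u - 1)) * b v
          - b v * (a u * d (u - 1) - c u * b (u - 1)))
        + ((u - v) • (c u * b v - b v * c u) - (a u * d v - a v * d u)) * b (u - 1) := by
  have h1 := congrArg (a u * ·) (hbd v (u - 1))
  have h2 := congrArg (a v * ·) (hbd u (u - 1))
  have h3 := congrArg (c u * ·) (hbb v (u - 1))
  simp only [mul_sub, sub_mul, smul_mul_assoc, mul_smul_comm, mul_assoc, smul_sub] at h1 h2 h3 ⊢
  linear_combination (norm := module) h2 - h1 - (u - v) • h3

/-- Commuting a quantum determinant with the lower right entry. -/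
theorem diagonal_identity
    (hcd : ∀ u v, (u - v) • (c u * d v - d v * c u) = c u * d v - c v * d u)
    (hbd : ∀ u v, (u - v) • (b u * d v - d v * b u) = d u * b v - d v * b u)
    (hdb : ∀ u v, (u - v) • (d u * b v - b v * d u) = b u * d v - b v * d u)
    (hdd : ∀ u v, d u * d v = d v * d u) (u v : K) :
    ((u - v) • (a u * d v - d v * a u) - (c u * b v - c v * b u)) * d (u - 1)
      = (u - v) • ((a u * d (u - 1) - c u * b (u - 1)) * d v
          - d v * (a u * d (u - 1) - c u * b (u - 1))) := by
  have h1 := congrArg (a u * ·) (hdd v (u - 1))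
  have h2 := congrArg (c u * ·) (hdb v (u - 1))
  have h3 := congrArg (· * b (u - 1)) (hcd u v)
  have h4 := congrArg (c v * ·) (hbd u (u - 1))
  simp only [mul_sub, sub_mul, smul_mul_assoc, mul_smul_comm, mul_assoc, smul_sub]
    at h1 h2 h3 h4 ⊢
  linear_combination (norm := module) (u - v) • h1 + h2 + h3 + h4

/-- Commuting a quantum determinant with the upper left entry. -/
theorem upper_left_identity
    (had : ∀ u v, (u - v) • (a u * d v - d v * a u) = c u * b v - c v * b u)
    (hab : ∀ u v, (u - v) • (a u * b v - b v * a u) = a u * b v - a v * b u)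
    (hac : ∀ u v, (u - v) • (a u * c v - c v * a u) = c u * a v - c v * a u)
    (hca : ∀ u v, (u - v) • (c u * a v - a v * c u) = a u * c v - a v * c u) (u v : K) :
    (v - u + 1) • ((a u * a v - a v * a u) * d (u - 1))
      = (v - u + 1) • ((a u * d (u - 1) - c u * b (u - 1)) * a v
          - a v * (a u * d (u - 1) - c u * b (u - 1))) := by
  have h1 := congrArg (a u * ·) (had v (u - 1))
  have h2 := congrArg (c u * ·) (hab v (u - 1))
  have h3 := congrArg (· * b v) (hac u (u - 1))
  have h4 := congrArg (· * b (u - 1)) (hca u v)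
  simp only [mul_sub, sub_mul, smul_mul_assoc, mul_smul_comm, mul_assoc, smul_sub]
    at h1 h2 h3 h4 ⊢
  linear_combination (norm := module) h1 - h2 - h3 - h4

end QuantumDeterminant

/-! ### Commutation properties of RTT matrices. -/

section Symmetry

variable {K R : Type*} [Field K] [Ring R] [Algebra K R]

/-- The relation says that `u - v - 1` kills the commutator, and after exchanging `u` and `v` so
does `v - u - 1`. These factors add up to `-2`, so no pair `u, v` is exceptional. -/
theorem IsRTT.commute_self [CharZero K] {T : Fin 2 → Fin 2 → K → R} (h : IsRTT T) (i j : Fin 2) (u v : K) :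
    T i j u * T i j v = T i j v * T i j u := by
  rcases eq_or_ne u v with rfl | huv
  · rfl
  have h1 := h i j i j u v
  have h2 := h i j i j v u
  have h3 : (2 : K) • (T i j u * T i j v - T i j v * T i j u) = 0 := by
    linear_combination (norm := module) h2 - h1
  exact sub_eq_zero.1 ((smul_eq_zero.1 h3).resolve_left two_ne_zero)

/-- The value of the quantum determinant at a scalar. -/
def quantumDet (T : Fin 2 → Fin 2 → K → R) (u : K) : R :=
  T 0 0 u * T 1 1 (u - 1) - T 1 0 u * T 0 1 (u - 1)

/-- The RTT relation at `v = u - 1`, where `u - v = 1`, transfers the shift to the other factors. In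
this form the determinant simplifies on vectors killed by `T 1 1 u`. -/
theorem IsRTT.quantumDet_eq {T : Fin 2 → Fin 2 → K → R} (h : IsRTT T) (u : K) :
    quantumDet T u = T 0 0 (u - 1) * T 1 1 u - T 0 1 (u - 1) * T 1 0 u := by
  have h1 := h 1 0 0 1 u (u - 1)
  unfold quantumDet
  linear_combination (norm := module) -h1

theorem IsRTT.quantumDet_eq' {T : Fin 2 → Fin 2 → K → R} (h : IsRTT T) (u : K) :
    quantumDet T u = T 1 1 (u - 1) * T 0 0 u - T 1 0 (u - 1) * T 0 1 u := by
  have h1 := h 0 0 1 1 u (u - 1)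
  unfold quantumDet
  linear_combination (norm := module) h1

/-- In `lower_identity` both brackets are RTT defects and vanish; what remains is `u - v` times the
commutator with the determinant. -/
theorem IsRTT.quantumDet_lower [CharZero K] {T : Fin 2 → Fin 2 → K → R} (h : IsRTT T) {u v : K}
    (huv : u ≠ v) : quantumDet T u * T 1 0 v = T 1 0 v * quantumDet T u := by
  have h1 := lower_identity (a := T 0 0) (b := T 0 1) (h 1 0 1 1) (h.commute_self 1 0) u v
  rw [h 0 0 1 0, h 0 1 1 0, sub_self, sub_self, mul_zero, mul_zero, add_zero,
    ← h.quantumDet_eq'] at h1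
  exact sub_eq_zero.1 ((smul_eq_zero.1 h1.symm).resolve_left (sub_ne_zero.2 huv))

theorem IsRTT.quantumDet_upper [CharZero K] {T : Fin 2 → Fin 2 → K → R} (h : IsRTT T) {u v : K}
    (huv : u ≠ v) : quantumDet T u * T 0 1 v = T 0 1 v * quantumDet T u := by
  have h1 := upper_identity (a := T 0 0) (c := T 1 0) (h 0 1 1 1) (h.commute_self 0 1) u v
  rw [h 0 0 0 1, h 1 0 0 1, sub_self, sub_self, zero_mul, zero_mul, add_zero] at h1
  exact sub_eq_zero.1 ((smul_eq_zero.1 h1.symm).resolve_left (sub_ne_zero.2 huv))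

end Symmetry

/-! ### Recovering the relations that involve `T_{11}` from a scalar quantum determinant. -/

section Completion

variable {K R : Type*} [Field K] [Ring R] [Algebra K R]

theorem monic_comp_X_sub_one {d : R[X]} (hd : d.Monic) : (d.comp (X - 1)).Monic := by
  have := hd.comp_X_sub_C (1 : R)
  simpa using this

/-- A single value of `d` may be a zero divisor, but the monic polynomial `d` is not. Cancellation
therefore takes place among polynomials in `u`, and `F` is needed to exhibit `f` as one. -/
theorem eq_zero_of_mul_shift [Infinite K] {d F : R[X]} (hd : d.Monic) {f : K → R}
    (hf : ∀ u, evalScalar u F = f u) (h : ∀ u, f u * evalScalar (u - 1) d = 0) (u : K) :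
    f u = 0 := by
  have : F * d.comp (X - 1) = 0 := eq_of_evalScalar (K := K) fun u => by
    rw [map_mul, evalScalar_comp_X_sub_one, hf, h, map_zero]
  rw [(monic_comp_X_sub_one hd).mul_left_eq_zero_iff] at this
  rw [← hf, this, map_zero]

theorem eq_zero_of_shift_mul [Infinite K] {d F : R[X]} (hd : d.Monic) {f : K → R}
    (hf : ∀ u, evalScalar u F = f u) (h : ∀ u, evalScalar (u - 1) d * f u = 0) (u : K) :
    f u = 0 := by
  have : d.comp (X - 1) * F = 0 := eq_of_evalScalar (K := K) fun u => by
    rw [map_mul, evalScalar_comp_X_sub_one, hf, h, map_zero]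
  rw [(monic_comp_X_sub_one hd).mul_right_eq_zero_iff] at this
  rw [← hf, this, map_zero]

theorem self_relation {r : K} {x y : R} (h : x * y = y * x) :
    r • (x * y - y * x) = x * y - y * x := by
  rw [h, sub_self, smul_zero]

/-- The relations not involving `T_{11}`, together with the relation that expresses `T_{11}`
through the quantum determinant, imply all `RTT` relations when the quantum determinant is
scalar and `T_{22}` is monic. -/
theorem isRTT_of_quantumDet [CharZero K] {T : Fin 2 → Fin 2 → R[X]} (hmonic : (T 1 1).Monic)
    {t : Fin 2 → Fin 2 → K → R} (ht : ∀ i j u, evalScalar u (T i j) = t i j u)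
    (hdd : ∀ u v, t 1 1 u * t 1 1 v = t 1 1 v * t 1 1 u)
    (hcc : ∀ u v, t 1 0 u * t 1 0 v = t 1 0 v * t 1 0 u)
    (hbb : ∀ u v, t 0 1 u * t 0 1 v = t 0 1 v * t 0 1 u)
    (hcd : ∀ u v, (u - v) • (t 1 0 u * t 1 1 v - t 1 1 v * t 1 0 u)
      = t 1 0 u * t 1 1 v - t 1 0 v * t 1 1 u)
    (hdc : ∀ u v, (u - v) • (t 1 1 u * t 1 0 v - t 1 0 v * t 1 1 u)
      = t 1 1 u * t 1 0 v - t 1 1 v * t 1 0 u)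
    (hbd : ∀ u v, (u - v) • (t 0 1 u * t 1 1 v - t 1 1 v * t 0 1 u)
      = t 1 1 u * t 0 1 v - t 1 1 v * t 0 1 u)
    (hdb : ∀ u v, (u - v) • (t 1 1 u * t 0 1 v - t 0 1 v * t 1 1 u)
      = t 0 1 u * t 1 1 v - t 0 1 v * t 1 1 u)
    (hcb : ∀ u v, (u - v) • (t 1 0 u * t 0 1 v - t 0 1 v * t 1 0 u)
      = t 0 0 u * t 1 1 v - t 0 0 v * t 1 1 u)
    (hsymm : ∀ u v, t 1 0 u * t 0 1 v - t 0 1 v * t 1 0 u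
      = t 1 0 v * t 0 1 u - t 0 1 u * t 1 0 v)
    (g : K → K) (hdet : ∀ u, quantumDet t u = algebraMap K R (g u)) : IsRTT t := by
  have hD : ∀ u, t 0 0 u * t 1 1 (u - 1) - t 1 0 u * t 0 1 (u - 1) = algebraMap K R (g u) := hdet
  have had : ∀ u v, (u - v) • (t 0 0 u * t 1 1 v - t 1 1 v * t 0 0 u)
      = t 1 0 u * t 0 1 v - t 1 0 v * t 0 1 u := by
    intro u v
    rw [← sub_eq_zero]
    -- `F` is the defect of the relation as a polynomial in `u` with `v` frozen. Multiplied by `t 1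
    -- 1 (u - 1)` it becomes a multiple of the commutator of the determinant with `t 1 1 v`, and the
    -- determinant is scalar.
    refine eq_zero_of_mul_shift (F := (X - C (algebraMap K R v)) *
      (T 0 0 * C (t 1 1 v) - C (t 1 1 v) * T 0 0) - (T 1 0 * C (t 0 1 v) - C (t 1 0 v) * T 0 1))
      (f := fun u => (u - v) • (t 0 0 u * t 1 1 v - t 1 1 v * t 0 0 u)
        - (t 1 0 u * t 0 1 v - t 1 0 v * t 0 1 u)) hmonic (fun u => ?_) (fun u => ?_) u
    · simp [ht, Algebra.smul_def]
    · rw [ht, diagonal_identity hcd hbd hdb hdd, hD, Algebra.commutes, sub_self, smul_zero]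
  have hda : ∀ u v, (u - v) • (t 1 1 u * t 0 0 v - t 0 0 v * t 1 1 u)
      = t 0 1 u * t 1 0 v - t 0 1 v * t 1 0 u := by
    intro u v
    linear_combination (norm := module) had v u - hsymm u v
  have hbc : ∀ u v, (u - v) • (t 0 1 u * t 1 0 v - t 1 0 v * t 0 1 u)
      = t 1 1 u * t 0 0 v - t 1 1 v * t 0 0 u := by
    intro u v
    rcases eq_or_ne u v with rfl | huv
    · simp
    have h1 : (u - v) • ((t 1 1 u * t 0 0 v - t 0 0 v * t 1 1 u)
        - (t 1 1 v * t 0 0 u - t 0 0 u * t 1 1 v)) = 0 := by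
      linear_combination (norm := module) hda u v + hda v u
    have h2 := (smul_eq_zero.1 h1).resolve_left (sub_ne_zero.2 huv)
    linear_combination (norm := module) hcb v u - h2
  have hD' : ∀ u, t 1 1 (u - 1) * t 0 0 u - t 1 0 (u - 1) * t 0 1 u = algebraMap K R (g u) := by
    intro u
    linear_combination (norm := module) hD u - had u (u - 1)
  have hac : ∀ u v, (u - v) • (t 0 0 u * t 1 0 v - t 1 0 v * t 0 0 u)
      = t 1 0 u * t 0 0 v - t 1 0 v * t 0 0 u := by
    intro u v
    rw [← sub_eq_zero]
    refine eq_zero_of_shift_mul (F := (X - C (algebraMap K R v)) *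
      (T 0 0 * C (t 1 0 v) - C (t 1 0 v) * T 0 0) - (T 1 0 * C (t 0 0 v) - C (t 1 0 v) * T 0 0))
      (f := fun u => (u - v) • (t 0 0 u * t 1 0 v - t 1 0 v * t 0 0 u)
        - (t 1 0 u * t 0 0 v - t 1 0 v * t 0 0 u)) hmonic (fun u => ?_) (fun u => ?_) u
    · simp [ht, Algebra.smul_def]
    · rw [ht, lower_identity hcd hcc, hD', Algebra.commutes, sub_self, smul_zero, hbc, sub_self,
        mul_zero, add_zero]
  have hca : ∀ u v, (u - v) • (t 1 0 u * t 0 0 v - t 0 0 v * t 1 0 u)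
      = t 0 0 u * t 1 0 v - t 0 0 v * t 1 0 u := by
    intro u v
    rcases eq_or_ne u v with rfl | huv
    · simp
    have h1 : (u - v) • ((t 0 0 u * t 1 0 v - t 1 0 v * t 0 0 u)
        - (t 0 0 v * t 1 0 u - t 1 0 u * t 0 0 v)) = 0 := by
      linear_combination (norm := module) hac u v + hac v u
    have h2 := (smul_eq_zero.1 h1).resolve_left (sub_ne_zero.2 huv)
    linear_combination (norm := module) hac v u - h2
  have hab : ∀ u v, (u - v) • (t 0 0 u * t 0 1 v - t 0 1 v * t 0 0 u)
      = t 0 0 u * t 0 1 v - t 0 0 v * t 0 1 u := by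
    intro u v
    rw [← sub_eq_zero]
    refine eq_zero_of_mul_shift (F := (X - C (algebraMap K R v)) *
      (T 0 0 * C (t 0 1 v) - C (t 0 1 v) * T 0 0) - (T 0 0 * C (t 0 1 v) - C (t 0 0 v) * T 0 1))
      (f := fun u => (u - v) • (t 0 0 u * t 0 1 v - t 0 1 v * t 0 0 u)
        - (t 0 0 u * t 0 1 v - t 0 0 v * t 0 1 u)) hmonic (fun u => ?_) (fun u => ?_) u
    · simp [ht, Algebra.smul_def]
    · rw [ht, upper_identity hbd hbb, hD, Algebra.commutes, sub_self, smul_zero, hcb, sub_self,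
        zero_mul, add_zero]
  have hba : ∀ u v, (u - v) • (t 0 1 u * t 0 0 v - t 0 0 v * t 0 1 u)
      = t 0 1 u * t 0 0 v - t 0 1 v * t 0 0 u := by
    intro u v
    rcases eq_or_ne u v with rfl | huv
    · simp
    have h1 : (u - v) • ((t 0 0 u * t 0 1 v - t 0 1 v * t 0 0 u)
        - (t 0 0 v * t 0 1 u - t 0 1 u * t 0 0 v)) = 0 := by
      linear_combination (norm := module) hab u v + hab v u
    have h2 := (smul_eq_zero.1 h1).resolve_left (sub_ne_zero.2 huv)
    linear_combination (norm := module) hab v u - h2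
  have haa' : ∀ u v, (v - u + 1) • (t 0 0 u * t 0 0 v - t 0 0 v * t 0 0 u) = 0 := by
    intro u v
    refine eq_zero_of_mul_shift (F := (C (algebraMap K R v) - X + 1) *
      (T 0 0 * C (t 0 0 v) - C (t 0 0 v) * T 0 0))
      (f := fun u => (v - u + 1) • (t 0 0 u * t 0 0 v - t 0 0 v * t 0 0 u)) hmonic
      (fun u => ?_) (fun u => ?_) u
    · simp [ht, Algebra.smul_def]
    · rw [ht, smul_mul_assoc, upper_left_identity had hab hac hca, hD, Algebra.commutes, sub_self,
        smul_zero]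
  have haa : ∀ u v, t 0 0 u * t 0 0 v - t 0 0 v * t 0 0 u = 0 := by
    intro u v
    -- If this factor vanishes, the factor `u - v + 1` obtained by exchanging `u` and `v` equals
    -- `2`.
    by_cases h : v - u + 1 = 0
    · have h1 := (smul_eq_zero.1 (haa' v u)).resolve_left (fun h' => two_ne_zero (α := K)
        (by linear_combination h + h'))
      rw [← neg_sub, h1, neg_zero]
    · exact (smul_eq_zero.1 (haa' u v)).resolve_left h
  intro i j k l u v
  fin_cases i <;> fin_cases j <;> fin_cases k <;> fin_cases l
  · exact self_relation (sub_eq_zero.1 (haa u v))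
  · exact hab u v
  · exact hac u v
  · exact had u v
  · exact hba u v
  · exact self_relation (hbb u v)
  · exact hbc u v
  · exact hbd u v
  · exact hca u v
  · exact hcb u v
  · exact self_relation (hcc u v)
  · exact hcd u v
  · exact hda u v
  · exact hdb u v
  · exact hdc u v
  · exact self_relation (hdd u v)

end Completion

/-! ### Action of the off-diagonal entries on eigenvectors of `T_{22}`. -/

section Eigenvectors

variable {K R N : Type*} [Field K] [Ring R] [Algebra K R]
  [AddCommGroup N] [Module K N] [Module R N] [IsScalarTower K R N]
  {T : Fin 2 → Fin 2 → R[X]}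

/-- The lower left entry, evaluated at a root of the eigenvalue of `T_{22}`, lowers the root. -/
theorem IsRTT.eigen_lower [Infinite K] (h : IsRTT (K := K) fun i j u => evalScalar u (T i j)) {η : N} {x : K}
    {r : K[X]} (hη : ∀ u : K, evalScalar u (T 1 1) • η = ((X - C x) * r).eval u • η) (u : K) :
    evalScalar u (T 1 1) • evalScalar x (T 1 0) • η
      = ((X - C (x - 1)) * r).eval u • evalScalar x (T 1 0) • η := by
  have hx : evalScalar x (T 1 1) • η = 0 := by simp [hη]
  have := evalScalar_smul_eq (S := {x}) (P := T 1 1)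
    (Q := ((X - C (x - 1)) * r).map (algebraMap K R)) (η := evalScalar x (T 1 0) • η)
    (ζ := evalScalar x (T 1 0) • η) (Set.finite_singleton x) (fun v hv => ?_) u
  · rw [this, evalScalar_map, algebraMap_smul]
  · have hv' : x - v ≠ 0 := sub_ne_zero.2 (Ne.symm hv)
    have h1 := congrArg (· • η) (h 1 0 1 1 x v)
    simp only [sub_smul, smul_assoc, mul_smul, hx, smul_zero, sub_zero, hη v] at h1
    rw [evalScalar_map, algebraMap_smul]
    refine (smul_right_injective N hv') ?_
    simp only [smul_comm (evalScalar x (T 1 0)) _ η] at h1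
    simp only [eval_mul, eval_sub, eval_X, eval_C] at h1 ⊢
    generalize evalScalar v (T 1 1) • evalScalar x (T 1 0) • η = A at h1 ⊢
    generalize evalScalar x (T 1 0) • η = B at h1 ⊢
    linear_combination (norm := module) -h1

/-- The upper right entry, evaluated at a root of the eigenvalue of `T_{22}`, raises the root. -/
theorem IsRTT.eigen_upper [Infinite K] (h : IsRTT (K := K) fun i j u => evalScalar u (T i j)) {η : N} {x : K}
    {r : K[X]} (hη : ∀ u : K, evalScalar u (T 1 1) • η = ((X - C x) * r).eval u • η) (u : K) :
    evalScalar u (T 1 1) • evalScalar x (T 0 1) • η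
      = ((X - C (x + 1)) * r).eval u • evalScalar x (T 0 1) • η := by
  have hx : evalScalar x (T 1 1) • η = 0 := by simp [hη]
  have := evalScalar_smul_eq (S := {x}) (P := T 1 1)
    (Q := ((X - C (x + 1)) * r).map (algebraMap K R)) (η := evalScalar x (T 0 1) • η)
    (ζ := evalScalar x (T 0 1) • η) (Set.finite_singleton x) (fun v hv => ?_) u
  · rw [this, evalScalar_map, algebraMap_smul]
  · have hv' : v - x ≠ 0 := sub_ne_zero.2 hv
    have h1 := congrArg (· • η) (h 1 1 0 1 v x)
    simp only [sub_smul, smul_assoc, mul_smul, hx, smul_zero, zero_sub, hη v] at h1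
    rw [evalScalar_map, algebraMap_smul]
    refine (smul_right_injective N hv') ?_
    simp only [smul_comm (evalScalar x (T 0 1)) _ η] at h1
    simp only [eval_mul, eval_sub, eval_X, eval_C] at h1 ⊢
    generalize evalScalar v (T 1 1) • evalScalar x (T 0 1) • η = A at h1 ⊢
    generalize evalScalar x (T 0 1) • η = B at h1 ⊢
    linear_combination (norm := module) h1

/-- The off-diagonal entries, evaluated at distinct roots of the eigenvalue of `T_{22}`, commute
on the eigenvector. -/
theorem IsRTT.swap_of_roots (h : IsRTT (K := K) fun i j u => evalScalar u (T i j)) {η : N}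
    {x y : K} (hxy : x ≠ y) (hx : evalScalar x (T 1 1) • η = 0)
    (hy : evalScalar y (T 1 1) • η = 0) :
    evalScalar x (T 0 1) • evalScalar y (T 1 0) • η
      = evalScalar y (T 1 0) • evalScalar x (T 0 1) • η := by
  have h1 := congrArg (· • η) (h 1 0 0 1 y x)
  -- The right side of the relation is `T_{11}(y) T_{22}(x) - T_{11}(x) T_{22}(y)`, which kills `η`
  -- at two roots.
  simp only [sub_smul, smul_assoc, mul_smul, hx, hy, smul_zero, sub_zero] at h1
  rw [← sub_smul] at h1
  exact (sub_eq_zero.1 ((smul_eq_zero.1 h1).resolve_left (sub_ne_zero.2 hxy.symm))).symm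

end Eigenvectors

/-! ### Roots and eigenvalue polynomials indexed by `ℤ^p`. -/

section Roots

variable {K : Type*} [Field K] {p : ℕ}

/-- The roots of the eigenvalue of `T_{22}(u)` on the vector with label `k`. -/
def root (β : Fin p → K) (k : Fin p → ℤ) (i : Fin p) : K := -β i - (k i : K)

/-- The eigenvalue of `T_{22}(u)` on the vector with label `k`. -/
noncomputable def rootPoly (β : Fin p → K) (k : Fin p → ℤ) : K[X] := ∏ i, (X + C (β i + (k i : K)))

/-- The eigenvalue of `T_{22}(u)` without its `i`-th factor. -/
noncomputable def coPoly (β : Fin p → K) (i : Fin p) (k : Fin p → ℤ) : K[X] :=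
  ∏ j ∈ Finset.univ.erase i, (X + C (β j + (k j : K)))

/-- The normalising factor of the interpolation polynomials. -/
noncomputable def coWeight (β : Fin p → K) (i : Fin p) (k : Fin p → ℤ) : K :=
  (∏ j ∈ Finset.univ.erase i, (β j - β i + (k j : K) - (k i : K)))⁻¹

theorem interp_eq (β : Fin p → K) (i : Fin p) (k : Fin p → ℤ) :
    interp β i k = C (coWeight β i k) * coPoly β i k := rfl

theorem rootPoly_eq (β : Fin p → K) (i : Fin p) (k : Fin p → ℤ) :
    rootPoly β k = (X - C (root β k i)) * coPoly β i k := by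
  unfold rootPoly coPoly
  rw [← Finset.mul_prod_erase _ _ (Finset.mem_univ i)]
  congr 1
  simp only [root, map_sub, map_neg, map_add]
  ring

theorem coPoly_congr (β : Fin p → K) (i : Fin p) {k k' : Fin p → ℤ}
    (h : ∀ j, j ≠ i → k j = k' j) : coPoly β i k = coPoly β i k' := by
  refine Finset.prod_congr rfl fun j hj => ?_
  rw [h j (Finset.ne_of_mem_erase hj)]

theorem rootPoly_add_single (β : Fin p → K) (i : Fin p) (k : Fin p → ℤ) :
    rootPoly β (k + Pi.single i 1) = (X - C (root β k i - 1)) * coPoly β i k := by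
  rw [rootPoly_eq β i, coPoly_congr β i (k' := k) fun j hj => by simp [hj]]
  congr 3
  simp [root]
  ring

theorem rootPoly_sub_single (β : Fin p → K) (i : Fin p) (k : Fin p → ℤ) :
    rootPoly β (k - Pi.single i 1) = (X - C (root β k i + 1)) * coPoly β i k := by
  rw [rootPoly_eq β i, coPoly_congr β i (k' := k) fun j hj => by simp [hj]]
  congr 3
  simp [root]
  ring

theorem root_add_single_self (β : Fin p → K) (i : Fin p) (k : Fin p → ℤ) :
    root β (k + Pi.single i 1) i = root β k i - 1 := by
  simp [root]
  ring

theorem root_sub_single_self (β : Fin p → K) (i : Fin p) (k : Fin p → ℤ) :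
    root β (k - Pi.single i 1) i = root β k i + 1 := by
  simp [root]
  ring

theorem root_add_single_of_ne (β : Fin p → K) {i j : Fin p} (h : j ≠ i) (k : Fin p → ℤ) :
    root β (k + Pi.single i 1) j = root β k j := by
  simp [root, h]

theorem root_sub_single_of_ne (β : Fin p → K) {i j : Fin p} (h : j ≠ i) (k : Fin p → ℤ) :
    root β (k - Pi.single i 1) j = root β k j := by
  simp [root, h]

theorem rootPoly_eval_root (β : Fin p → K) (i : Fin p) (k : Fin p → ℤ) :
    (rootPoly β k).eval (root β k i) = 0 := by
  rw [rootPoly_eq β i]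
  simp

theorem monic_rootPoly (β : Fin p → K) (k : Fin p → ℤ) : (rootPoly β k).Monic :=
  monic_prod_of_monic _ _ fun _ _ => monic_X_add_C _

theorem natDegree_rootPoly (β : Fin p → K) (k : Fin p → ℤ) : (rootPoly β k).natDegree = p := by
  unfold rootPoly
  rw [natDegree_prod_of_monic _ _ fun _ _ => monic_X_add_C _]
  simp only [natDegree_X_add_C, Finset.sum_const, Finset.card_univ, Fintype.card_fin,
    smul_eq_mul, mul_one]

theorem root_sub_root_ne {β : Fin p → K} (hβ : ∀ i j : Fin p, i ≠ j → ∀ m : ℤ, β i - β j ≠ (m : K))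
    (k k' : Fin p → ℤ) {i j : Fin p} (hij : i ≠ j) (m : ℤ) :
    root β k i - root β k' j ≠ (m : K) := by
  intro h
  refine hβ i j hij (k' j - k i - m) ?_
  push_cast
  rw [← h]
  simp only [root]
  ring

theorem root_injective {β : Fin p → K} (hβ : ∀ i j : Fin p, i ≠ j → ∀ m : ℤ, β i - β j ≠ (m : K))
    (k : Fin p → ℤ) : Function.Injective (root β k) := by
  intro i j h
  by_contra hij
  exact root_sub_root_ne hβ k k hij 0 (by simp [h])

theorem interp_eq_basis (β : Fin p → K) (i : Fin p) (k : Fin p → ℤ) :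
    interp β i k = Lagrange.basis Finset.univ (root β k) i := by
  unfold interp Lagrange.basis Lagrange.basisDivisor
  rw [Finset.prod_mul_distrib, ← map_prod, Finset.prod_inv_distrib]
  congr 1
  · congr 2
    refine Finset.prod_congr rfl fun j _ => ?_
    simp only [root]
    ring
  · refine Finset.prod_congr rfl fun j _ => ?_
    simp only [root, map_sub, map_neg, map_add]
    ring

/-- Induction over `ℤ^p`, first descending and then ascending. -/
theorem lattice_induction {Q : (Fin p → ℤ) → Prop} (h0 : Q 0)
    (hneg : ∀ k i, (∀ j, k j ≤ 0) → Q k → Q (k - Pi.single i 1))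
    (hpos : ∀ k i, 0 ≤ k i → Q k → Q (k + Pi.single i 1)) (k : Fin p → ℤ) : Q k := by
  induction hn : ∑ i, (k i).natAbs using Nat.strong_induction_on generalizing k with
  | _ n ih =>
  by_cases hk : ∃ i, 0 < k i
  · obtain ⟨i, hi⟩ := hk
    have e : k = (k - Pi.single i 1) + Pi.single i 1 := by simp
    rw [e]
    refine hpos _ i (by simp; omega) (ih _ ?_ _ rfl)
    rw [← hn]
    refine Finset.sum_lt_sum (fun j _ => ?_) ⟨i, Finset.mem_univ i, by simp; omega⟩
    rcases eq_or_ne j i with rfl | hj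
    · simp; omega
    · simp [hj]
  · push Not at hk
    by_cases hk' : ∃ i, k i < 0
    · obtain ⟨i, hi⟩ := hk'
      have e : k = (k + Pi.single i 1) - Pi.single i 1 := by simp
      rw [e]
      refine hneg _ i (fun j => ?_) (ih _ ?_ _ rfl)
      · rcases eq_or_ne j i with rfl | hj
        · simp; omega
        · simp [hj, hk]
      rw [← hn]
      refine Finset.sum_lt_sum (fun j _ => ?_) ⟨i, Finset.mem_univ i, by simp; omega⟩
      rcases eq_or_ne j i with rfl | hj
      · simp; omega
      · simp [hj]
    · push Not at hk'
      have : k = 0 := funext fun i => le_antisymm (hk i) (hk' i)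
      rwa [this]

end Roots

/-! ### The ordered products defining `ξ^{(k)}`. -/

section Products

theorem prod_ofFn_eq_mul {M : Type*} [Monoid M] (x : M) : ∀ {n : ℕ} (f g : Fin n → M) (i : Fin n),
    g i = x * f i → (∀ j, j ≠ i → g j = f j) → (∀ j, Commute x (f j)) →
    (List.ofFn g).prod = x * (List.ofFn f).prod := by
  intro n
  induction n with
  | zero => intro f g i; exact i.elim0
  | succ n ih =>
    intro f g i hi hj hc
    rw [List.ofFn_succ, List.ofFn_succ, List.prod_cons, List.prod_cons]
    induction i using Fin.cases with
    | zero =>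
      have : (fun i : Fin n => g i.succ) = fun i => f i.succ :=
        funext fun j => hj _ (Fin.succ_ne_zero j)
      rw [hi, this, mul_assoc]
    | succ i =>
      rw [hj 0 (Fin.succ_ne_zero i).symm, ih (fun i => f i.succ) (fun i => g i.succ) i hi
        (fun j hne => hj _ fun h => hne (Fin.succ_injective _ h)) (fun j => hc _),
        ← mul_assoc, ← (hc 0).eq, mul_assoc]

variable {K : Type*} [Field K] {p : ℕ}

/-- The descending products of values of the off-diagonal entry `T_{ij}`. -/
noncomputable def stepProd (i j : Fin 2) (x : Fin p → ℕ → K) (n : Fin p → ℕ) : Yangian K p :=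
  (List.ofFn fun l : Fin p =>
    ((List.range (n l)).reverse.map fun m : ℕ => evalAt (T K p i j) (x l m)).prod).prod

theorem stepProd_succ [CharZero K] (i j : Fin 2) (x : Fin p → ℕ → K) {n n' : Fin p → ℕ}
    {l : Fin p} (hl : n' l = n l + 1) (h : ∀ l', l' ≠ l → n' l' = n l') :
    stepProd i j x n' = evalScalar (x l (n l)) (T K p i j) * stepProd i j x n := by
  refine prod_ofFn_eq_mul _ _ _ l ?_ (fun l' hl' => ?_) (fun l' => ?_)
  · rw [hl, List.range_succ, List.reverse_append, List.map_append, List.prod_append]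
    simp [evalAt_eq_evalScalar]
  · rw [h l' hl']
  · refine Commute.list_prod_right _ _ fun y hy => ?_
    obtain ⟨m, -, rfl⟩ := List.mem_map.1 hy
    exact isRTT_yangian.commute_self i j _ _

theorem stepProd_zero (i j : Fin 2) (x : Fin p → ℕ → K) {n : Fin p → ℕ} (h : ∀ l, n l = 0) :
    stepProd i j x n = 1 := by
  refine List.prod_eq_one fun y hy => ?_
  obtain ⟨l, rfl⟩ := (List.mem_ofFn' _ _).1 hy
  simp [h]

theorem tau_eq (β : Fin p → K) (k : Fin p → ℤ) :
    tau β k = stepProd 1 0 (fun i m => -β i - (m : K)) (fun i => (k i).toNat)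
      * stepProd 0 1 (fun i m => -β i + (m : K)) (fun i => (-k i).toNat) := rfl

theorem tau_add_single [CharZero K] (β : Fin p → K) {k : Fin p → ℤ} {i : Fin p} (hi : 0 ≤ k i) :
    tau β (k + Pi.single i 1) = evalScalar (root β k i) (T K p 1 0) * tau β k := by
  rw [tau_eq, tau_eq, stepProd_succ (n := fun i => (k i).toNat) (l := i), mul_assoc]
  · have e : -β i - (((k i).toNat : ℕ) : K) = root β k i := by
      have : ((k i).toNat : ℤ) = k i := Int.toNat_of_nonneg hi
      have h2 : (((k i).toNat : ℕ) : K) = ((k i : ℤ) : K) := by rw [← Int.cast_natCast, this]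
      rw [root, h2]
    have e' : (fun j => (-(k + Pi.single i 1 : Fin p → ℤ) j).toNat) = fun j => (-k j).toNat := by
      funext j
      rcases eq_or_ne j i with rfl | hj
      · simp; omega
      · simp [hj]
    rw [e, e']
  · simp; omega
  · intro j hj
    simp [hj]

/-- With all labels nonpositive the product of `T_{21}` values is empty, so the new `T_{12}` factor
joins its own product without having to pass any `T_{21}`. -/
theorem tau_sub_single [CharZero K] (β : Fin p → K) {k : Fin p → ℤ} (hk : ∀ j, k j ≤ 0)
    (i : Fin p) :
    tau β (k - Pi.single i 1) = evalScalar (root β k i) (T K p 0 1) * tau β k := by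
  rw [tau_eq, tau_eq, stepProd_zero 1 0, stepProd_zero 1 0, one_mul, one_mul,
    stepProd_succ (n := fun i => (-k i).toNat) (l := i)]
  · have e : -β i + (((-k i).toNat : ℕ) : K) = root β k i := by
      have : ((-k i).toNat : ℤ) = -k i := Int.toNat_of_nonneg (by have := hk i; omega)
      have h2 : (((-k i).toNat : ℕ) : K) = ((-k i : ℤ) : K) := by
        rw [← Int.cast_natCast, this]
      rw [h2, root]
      push_cast
      ring
    rw [e]
  · have := hk i
    simp; omega
  · intro j hj
    simp [hj]
  · intro j
    have := hk j
    simp [this]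
  · intro j
    have := hk j
    rcases eq_or_ne j i with rfl | hj
    · simp; omega
    · simp [hj, this]

end Products

/-! ### Coefficients of the generating polynomials and stable subspaces. -/

section YangianGenerators

variable {K : Type*} [Field K] {p : ℕ}

theorem coeff_T_of_mem {i j : Fin 2} {r : ℕ} (h1 : 1 ≤ r) (hr : r ≤ p) :
    (T K p i j).coeff (p - r) = t K p i j r := by
  have h0 : (if i = j then (X ^ p : (Yangian K p)[X]) else 0).coeff (p - r) = 0 := by
    split_ifs
    · rw [coeff_X_pow, if_neg (by omega)]
    · simp
  unfold T
  rw [coeff_add, h0, zero_add, finsetSum_coeff, Finset.sum_eq_single r]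
  · simp
  · intro s hs hne
    have := Finset.mem_Icc.1 hs
    rw [coeff_C_mul_X_pow, if_neg (by omega)]
  · intro hr'
    exact absurd (Finset.mem_Icc.2 ⟨h1, hr⟩) hr'

theorem degree_sum_lt (i j : Fin 2) :
    (∑ k ∈ Finset.Icc 1 p, C (t K p i j k) * X ^ (p - k)).degree < (p : WithBot ℕ) := by
  rw [degree_lt_iff_coeff_zero]
  intro m hm
  rw [finsetSum_coeff]
  refine Finset.sum_eq_zero fun k hk => ?_
  have := Finset.mem_Icc.1 hk
  rw [coeff_C_mul_X_pow, if_neg (by omega)]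

theorem degree_T_lt {i j : Fin 2} (hij : i ≠ j) : (T K p i j).degree < (p : WithBot ℕ) := by
  unfold T
  rw [if_neg hij, zero_add]
  exact degree_sum_lt i j

/-- A set of vectors that is stable under the generators is stable under the Yangian. -/
theorem smul_mem_of_generators {N : Type*} [AddCommGroup N] [Module K N] [Module (Yangian K p) N]
    [IsScalarTower K (Yangian K p) N] (W : Submodule K N)
    (h : ∀ i j n, ∀ w ∈ W, (T K p i j).coeff n • w ∈ W) (y : Yangian K p) {w : N} (hw : w ∈ W) :
    y • w ∈ W := by
  obtain ⟨f, rfl⟩ := RingQuot.mkAlgHom_surjective K (Rel K p) y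
  let φ : FreeAlgebra K (Fin 2 × Fin 2 × Fin p) →ₐ[K] Yangian K p := RingQuot.mkAlgHom K (Rel K p)
  change φ f • w ∈ W
  induction f using FreeAlgebra.induction generalizing w with
  | grade0 r =>
    rw [AlgHom.commutes, algebraMap_smul]
    exact W.smul_mem r hw
  | grade1 x =>
    obtain ⟨i, j, m⟩ := x
    have e : φ (FreeAlgebra.ι K (i, j, m)) = (T K p i j).coeff (p - (m + 1)) := by
      rw [coeff_T_of_mem (by omega) (by omega)]
      unfold t freeGen
      simp only [m.2, dif_pos]
      rfl
    rw [e]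
    exact h _ _ _ _ hw
  | mul a b ha hb =>
    rw [map_mul, mul_smul]
    exact ha (hb hw)
  | add a b ha hb =>
    rw [map_add, add_smul]
    exact W.add_mem (ha hw) (hb hw)

end YangianGenerators

/-! ### Explicit action on the vectors `ξ^{(k)}`, spanning, and uniqueness of `T_{11}`. -/

section UniversalModule

variable {K : Type*} [Field K] {p : ℕ} {β : Fin p → K} {γ : Fin (2 * p) → K}

theorem evalScalar_D (u : K) :
    evalScalar u (D K p) = quantumDet (fun i j u => evalScalar u (T K p i j)) u := by
  unfold D quantumDet
  rw [map_sub, map_mul, map_mul, evalScalar_comp_X_sub_one, evalScalar_comp_X_sub_one]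

theorem coeff_smul_mk_one {P : (Yangian K p)[X]} {q : K[X]}
    (h : ∀ n, (P - q.map (algebraMap K (Yangian K p))).coeff n ∈ leftIdeal β γ) (n : ℕ) :
    P.coeff n • Submodule.Quotient.mk (p := leftIdeal β γ) (1 : Yangian K p)
      = (q.map (algebraMap K (Yangian K p))).coeff n •
        Submodule.Quotient.mk (p := leftIdeal β γ) (1 : Yangian K p) := by
  rw [← Submodule.Quotient.mk_smul, ← Submodule.Quotient.mk_smul, Submodule.Quotient.eq,
    smul_eq_mul, smul_eq_mul, mul_one, mul_one, ← coeff_sub]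
  exact h n

theorem xi_zero : xi β γ 0 = Submodule.Quotient.mk (1 : Yangian K p) := by
  unfold xi
  rw [tau_eq, stepProd_zero, stepProd_zero, one_mul, one_smul] <;> simp

theorem xi_add_single [CharZero K] {k : Fin p → ℤ} {i : Fin p} (hi : 0 ≤ k i) :
    xi β γ (k + Pi.single i 1) = evalScalar (root β k i) (T K p 1 0) • xi β γ k := by
  unfold xi
  rw [tau_add_single β hi, mul_smul]

/-- The two claims are proved together. Lowering a label `k i ≤ 0` when other labels are positive
means moving `T_{12}` past a `T_{21}`; this is allowed at distinct roots of an eigenvector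
(`swap_of_roots`), so the eigenvalue at the previous label is needed. -/
theorem xi_eigen_and_sub_single [CharZero K]
    (hβ : ∀ i j : Fin p, i ≠ j → ∀ m : ℤ, β i - β j ≠ (m : K)) (k : Fin p → ℤ) :
    (∀ u : K, evalScalar u (T K p 1 1) • xi β γ k = (rootPoly β k).eval u • xi β γ k) ∧
    ∀ i, k i ≤ 0 →
      xi β γ (k - Pi.single i 1) = evalScalar (root β k i) (T K p 0 1) • xi β γ k := by
  have hsub : ∀ k : Fin p → ℤ, (∀ j, k j ≤ 0) → ∀ i,
      xi β γ (k - Pi.single i 1) = evalScalar (root β k i) (T K p 0 1) • xi β γ k := by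
    intro k hk i
    unfold xi
    rw [tau_sub_single β hk, mul_smul]
  induction k using lattice_induction with
  | h0 =>
    refine ⟨fun u => ?_, fun i _ => hsub 0 (fun _ => le_rfl) i⟩
    have := evalScalar_smul_eq_of_coeff (K := K) (coeff_smul_mk_one (β := β) (γ := γ)
      (P := T K p 1 1) (q := shiftPoly β)
      fun n => Submodule.subset_span (Or.inl ⟨n, rfl⟩)) u
    rw [xi_zero, this, evalScalar_map, algebraMap_smul]
    simp [shiftPoly, rootPoly]
  | hneg k i hk ih =>
    refine ⟨fun u => ?_, fun j _ => hsub _ (fun l => ?_) j⟩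
    · rw [hsub k hk i, rootPoly_sub_single]
      refine isRTT_yangian.eigen_upper (fun u => ?_) u
      rw [ih.1, ← rootPoly_eq]
    · have := hk l
      rcases eq_or_ne l i with rfl | hl
      · simp; omega
      · simpa [hl]
  | hpos k i hi ih =>
    refine ⟨fun u => ?_, fun j hj => ?_⟩
    · rw [xi_add_single hi, rootPoly_add_single]
      refine isRTT_yangian.eigen_lower (fun u => ?_) u
      rw [ih.1, ← rootPoly_eq]
    · have hji : j ≠ i := by
        rintro rfl
        simp at hj
        omega
      have hj' : k j ≤ 0 := by simpa [hji] using hj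
      have e : k + Pi.single i 1 - Pi.single j 1 = k - Pi.single j 1 + Pi.single i 1 := by abel
      rw [e, xi_add_single (by simpa [hji.symm] using hi), ih.2 j hj', xi_add_single hi,
        root_add_single_of_ne β hji, root_sub_single_of_ne β hji.symm]
      refine (isRTT_yangian.swap_of_roots ?_ ?_ ?_).symm
      · intro h
        exact hji (root_injective hβ k h)
      · rw [ih.1, rootPoly_eval_root, zero_smul]
      · rw [ih.1, rootPoly_eval_root, zero_smul]

theorem T22_smul_xi [CharZero K]
    (hβ : ∀ i j : Fin p, i ≠ j → ∀ m : ℤ, β i - β j ≠ (m : K)) (k : Fin p → ℤ) (u : K) :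
    evalScalar u (T K p 1 1) • xi β γ k = (rootPoly β k).eval u • xi β γ k :=
  (xi_eigen_and_sub_single hβ k).1 u

theorem T22_root_smul_xi [CharZero K]
    (hβ : ∀ i j : Fin p, i ≠ j → ∀ m : ℤ, β i - β j ≠ (m : K)) (k : Fin p → ℤ) (i : Fin p) :
    evalScalar (root β k i) (T K p 1 1) • xi β γ k = 0 := by
  rw [T22_smul_xi hβ, rootPoly_eval_root, zero_smul]

theorem quantumDet_smul_xi [CharZero K]
    (hβ : ∀ i j : Fin p, i ≠ j → ∀ m : ℤ, β i - β j ≠ (m : K)) (k : Fin p → ℤ) (u : K) :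
    quantumDet (fun i j u => evalScalar u (T K p i j)) u • xi β γ k
      = (shiftPoly γ).eval u • xi β γ k := by
  rw [← evalScalar_D]
  -- Commutation of the determinant at `v` with an off-diagonal value at `x` is available for `v ≠
  -- x` only; polynomiality in `v` supplies the missing point.
  have step : ∀ {η : UniversalModule β γ} {y : Yangian K p} {x : K},
      (∀ u : K, evalScalar u (D K p) • η = (shiftPoly γ).eval u • η) →
      (∀ v, v ≠ x → evalScalar v (D K p) * y = y * evalScalar v (D K p)) →
      ∀ u : K, evalScalar u (D K p) • y • η = (shiftPoly γ).eval u • y • η := by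
    intro η y x hη hy u
    have := evalScalar_smul_eq (S := {x}) (P := D K p)
      (Q := (shiftPoly γ).map (algebraMap K (Yangian K p))) (η := y • η) (ζ := y • η)
      (Set.finite_singleton x) (fun v hv => ?_) u
    · rw [this, evalScalar_map, algebraMap_smul]
    · rw [evalScalar_map, algebraMap_smul, ← mul_smul, hy v hv, mul_smul, hη, smul_comm]
  induction k using lattice_induction generalizing u with
  | h0 =>
    have := evalScalar_smul_eq_of_coeff (K := K) (coeff_smul_mk_one (β := β) (γ := γ)
      (P := D K p) (q := shiftPoly γ)
      fun n => Submodule.subset_span (Or.inr ⟨n, rfl⟩)) u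
    rw [xi_zero, this, evalScalar_map, algebraMap_smul]
  | hneg k i hk ih =>
    rw [(xi_eigen_and_sub_single hβ k).2 i (hk i)]
    refine step ih (x := root β k i) (fun v hv => ?_) u
    rw [evalScalar_D]
    exact isRTT_yangian.quantumDet_upper hv
  | hpos k i hi ih =>
    rw [xi_add_single hi]
    refine step ih (x := root β k i) (fun v hv => ?_) u
    rw [evalScalar_D]
    exact isRTT_yangian.quantumDet_lower hv

theorem T21_root_smul_xi [CharZero K]
    (hβ : ∀ i j : Fin p, i ≠ j → ∀ m : ℤ, β i - β j ≠ (m : K)) (k : Fin p → ℤ) (i : Fin p) :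
    evalScalar (root β k i) (T K p 1 0) • xi β γ k
      = LevelYangian.A β γ i k • xi β γ (k + Pi.single i 1) := by
  by_cases hi : 0 ≤ k i
  · rw [xi_add_single hi, LevelYangian.A, if_pos hi, one_smul]
  · rw [LevelYangian.A, if_neg hi]
    -- With `x = root β k i`, the vector is `T_{12}(x - 1) ξ^{(k + δ_i)}`, and `T_{22}(x - 1)` kills
    -- `ξ^{(k + δ_i)}`. The determinant at `x` thus reduces to `-T_{21}(x) T_{12}(x - 1)`.
    have h1 := (xi_eigen_and_sub_single (γ := γ) hβ (k + Pi.single i 1)).2 i (by simp; omega)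
    have h2 := T22_root_smul_xi (γ := γ) hβ (k + Pi.single i 1) i
    have h3 := quantumDet_smul_xi (γ := γ) hβ (k + Pi.single i 1) (root β k i)
    rw [add_sub_cancel_right, root_add_single_self] at h1
    rw [root_add_single_self] at h2
    rw [quantumDet, sub_smul, mul_smul, mul_smul, h2, smul_zero, zero_sub, ← h1] at h3
    rw [neg_smul, ← root, ← h3, neg_neg]

theorem T12_root_smul_xi [CharZero K]
    (hβ : ∀ i j : Fin p, i ≠ j → ∀ m : ℤ, β i - β j ≠ (m : K)) (k : Fin p → ℤ) (i : Fin p) :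
    evalScalar (root β k i) (T K p 0 1) • xi β γ k
      = LevelYangian.B β γ i k • xi β γ (k - Pi.single i 1) := by
  by_cases hi : 0 < k i
  · rw [LevelYangian.B, if_pos hi]
    have h1 := xi_add_single (β := β) (γ := γ) (k := k - Pi.single i 1) (i := i) (by simp; omega)
    have h2 := T22_root_smul_xi (γ := γ) hβ (k - Pi.single i 1) i
    have h3 := quantumDet_smul_xi (γ := γ) hβ (k - Pi.single i 1) (root β k i + 1)
    rw [sub_add_cancel, root_sub_single_self] at h1
    rw [root_sub_single_self] at h2
    -- Here `T_{22}` vanishes at `root β k i + 1` itself, so the determinant is taken in the form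
    -- with `T_{22}` unshifted.
    rw [isRTT_yangian.quantumDet_eq, sub_smul, mul_smul, mul_smul, h2, smul_zero, zero_sub, ← h1,
      add_sub_cancel_right] at h3
    rw [neg_smul, ← root, ← h3, neg_neg]
  · rw [LevelYangian.B, if_neg hi, one_smul, (xi_eigen_and_sub_single hβ k).2 i (by omega)]

theorem coeff_T22_smul_xi [CharZero K]
    (hβ : ∀ i j : Fin p, i ≠ j → ∀ m : ℤ, β i - β j ≠ (m : K)) (k : Fin p → ℤ) (n : ℕ) :
    (T K p 1 1).coeff n • xi β γ k = (rootPoly β k).coeff n • xi β γ k := by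
  rw [coeff_smul_eq (K := K) (Q := (rootPoly β k).map (algebraMap K (Yangian K p)))
    (ζ := xi β γ k) Set.finite_empty, coeff_map, algebraMap_smul]
  intro u _
  rw [evalScalar_map, algebraMap_smul, T22_smul_xi hβ]

theorem coeff_T21_smul_xi [CharZero K]
    (hβ : ∀ i j : Fin p, i ≠ j → ∀ m : ℤ, β i - β j ≠ (m : K)) (k : Fin p → ℤ) (n : ℕ) :
    (T K p 1 0).coeff n • xi β γ k = ∑ i, (LevelYangian.A β γ i k * (interp β i k).coeff n) •
      xi β γ (k + Pi.single i 1) := by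
  rw [coeff_smul_eq_sum_basis (root_injective hβ k) (by simpa using degree_T_lt (by decide))]
  refine Finset.sum_congr rfl fun i _ => ?_
  rw [T21_root_smul_xi hβ, interp_eq_basis, smul_smul, mul_comm]

theorem coeff_T12_smul_xi [CharZero K]
    (hβ : ∀ i j : Fin p, i ≠ j → ∀ m : ℤ, β i - β j ≠ (m : K)) (k : Fin p → ℤ) (n : ℕ) :
    (T K p 0 1).coeff n • xi β γ k = ∑ i, (LevelYangian.B β γ i k * (interp β i k).coeff n) •
      xi β γ (k - Pi.single i 1) := by
  rw [coeff_smul_eq_sum_basis (root_injective hβ k) (by simpa using degree_T_lt (by decide))]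
  refine Finset.sum_congr rfl fun i _ => ?_
  rw [T12_root_smul_xi hβ, interp_eq_basis, smul_smul, mul_comm]

theorem coeff_D_smul_xi [CharZero K]
    (hβ : ∀ i j : Fin p, i ≠ j → ∀ m : ℤ, β i - β j ≠ (m : K)) (k : Fin p → ℤ) (n : ℕ) :
    (D K p).coeff n • xi β γ k = (shiftPoly γ).coeff n • xi β γ k := by
  rw [coeff_smul_eq (K := K) (Q := (shiftPoly γ).map (algebraMap K (Yangian K p)))
    (ζ := xi β γ k) Set.finite_empty, coeff_map, algebraMap_smul]
  intro u _
  rw [evalScalar_map, algebraMap_smul, evalScalar_D, quantumDet_smul_xi hβ]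

theorem finite_shifted_roots (β : Fin p → K) (k : Fin p → ℤ) :
    {u : K | (rootPoly β k).eval (u - 1) = 0}.Finite := by
  have := (((rootPoly β k).comp (X - C 1)).rootSet_finite K)
  refine this.subset fun u hu => ?_
  rw [mem_rootSet]
  refine ⟨((monic_rootPoly β k).comp_X_sub_C 1).ne_zero, ?_⟩
  simpa using hu

theorem evalScalar_smul_mem {R N : Type*} [Ring R] [Algebra K R] [AddCommGroup N] [Module K N]
    [Module R N] [IsScalarTower K R N] {W : Submodule K N} {P : R[X]} {η : N}
    (h : ∀ n, P.coeff n • η ∈ W) (u : K) : evalScalar u P • η ∈ W := by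
  rw [evalScalar_eq_sum, Finset.sum_smul]
  refine W.sum_mem fun n _ => ?_
  rw [smul_assoc]
  exact W.smul_mem _ (h n)

/-- Only stability under `T_{11}` is not read off a formula. The determinant places a multiple of
`T_{11}(u) ξ^{(k)}` in the span, with multiplier the eigenvalue of `T_{22}(u - 1)`, nonzero for all
but finitely many `u`. -/
theorem span_xi [CharZero K] (hβ : ∀ i j : Fin p, i ≠ j → ∀ m : ℤ, β i - β j ≠ (m : K)) :
    Submodule.span K (Set.range (xi β γ)) = ⊤ := by
  set W := Submodule.span K (Set.range (xi β γ)) with hW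
  have hxi : ∀ k, xi β γ k ∈ W := fun k => Submodule.subset_span ⟨k, rfl⟩
  have extend : ∀ y : Yangian K p, (∀ k, y • xi β γ k ∈ W) → ∀ w ∈ W, y • w ∈ W := by
    intro y hy w hw
    induction hw using Submodule.span_induction with
    | mem x hx => obtain ⟨k, rfl⟩ := hx; exact hy k
    | zero => rw [smul_zero]; exact W.zero_mem
    | add x y _ _ hx hy => rw [smul_add]; exact W.add_mem hx hy
    | smul c x _ hx => rw [smul_comm]; exact W.smul_mem c hx
  have h22 : ∀ n, ∀ w ∈ W, (T K p 1 1).coeff n • w ∈ W := fun n => extend _ fun k => by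
    rw [coeff_T22_smul_xi hβ]
    exact W.smul_mem _ (hxi k)
  have h21 : ∀ n, ∀ w ∈ W, (T K p 1 0).coeff n • w ∈ W := fun n => extend _ fun k => by
    rw [coeff_T21_smul_xi hβ]
    exact W.sum_mem fun i _ => W.smul_mem _ (hxi _)
  have h12 : ∀ n, ∀ w ∈ W, (T K p 0 1).coeff n • w ∈ W := fun n => extend _ fun k => by
    rw [coeff_T12_smul_xi hβ]
    exact W.sum_mem fun i _ => W.smul_mem _ (hxi _)
  have h11 : ∀ n, ∀ w ∈ W, (T K p 0 0).coeff n • w ∈ W := fun n => extend _ fun k => by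
    refine coeff_smul_mem (finite_shifted_roots β k) (fun u hu => ?_) n
    have h1 := quantumDet_smul_xi (γ := γ) hβ k u
    rw [quantumDet, sub_smul, mul_smul, mul_smul, T22_smul_xi hβ, sub_eq_iff_eq_add, smul_comm]
      at h1
    rw [← W.smul_mem_iff hu, h1]
    exact W.add_mem (W.smul_mem _ (hxi k)) (evalScalar_smul_mem (fun n => h21 n _
      (evalScalar_smul_mem (fun n => h12 n _ (hxi k)) _)) _)
  rw [eq_top_iff]
  rintro x -
  obtain ⟨y, rfl⟩ := Submodule.Quotient.mk_surjective _ x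
  have := smul_mem_of_generators W (fun i j => by
    fin_cases i <;> fin_cases j
    · exact h11
    · exact h12
    · exact h21
    · exact h22) y (hxi 0)
  rwa [xi_zero, ← Submodule.Quotient.mk_smul, smul_eq_mul, mul_one] at this

theorem evalScalar_act (P : (Yangian K p)[X]) (u : K) (η : UniversalModule β γ) :
    evalScalar u (act β γ P) η = evalScalar u P • η := by
  have e : algebraMap K (Module.End K (UniversalModule β γ)) u
      = (Algebra.lsmul K K (UniversalModule β γ)).toRingHom (algebraMap K (Yangian K p) u) :=
    ((Algebra.lsmul K K (UniversalModule β γ)).commutes u).symm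
  rw [evalScalar_apply, act, e, eval_map, eval₂_at_apply]
  rfl

/-- The quantum determinant relation determines the action of `T_{11}(u)`. -/
theorem eq_act_T11 [CharZero K] (hβ : ∀ i j : Fin p, i ≠ j → ∀ m : ℤ, β i - β j ≠ (m : K))
    (F : (Module.End K (UniversalModule β γ))[X])
    (hF : ∀ (k : Fin p → ℤ) (n : ℕ),
      (F * act β γ ((T₂₂ K p).comp (X - 1))
        - act β γ (T₂₁ K p) * act β γ ((T₁₂ K p).comp (X - 1))).coeff n (xi β γ k)
      = (shiftPoly γ).coeff n • xi β γ k) :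
    F = act β γ (T₁₁ K p) := by
  ext1 n
  refine LinearMap.ext_on_range (span_xi hβ) fun k => ?_
  -- Equality of the coefficients follows from equality of values at those `u` where the eigenvalue
  -- of `T_{22}(u - 1)` can be cancelled.
  refine coeff_smul_eq (K := K) (R := Module.End K (UniversalModule β γ))
    (η := xi β γ k) (ζ := xi β γ k) (finite_shifted_roots β k) (fun u hu => ?_) n
  have h1 := evalScalar_smul_eq_of_coeff (K := K) (R := Module.End K (UniversalModule β γ))
    (η := xi β γ k) (ζ := xi β γ k) (Q := (shiftPoly γ).map (algebraMap K _))
    (fun n => (hF k n).trans (by rw [coeff_map, algebraMap_smul])) u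
  have h2 := quantumDet_smul_xi (γ := γ) hβ k u
  rw [evalScalar_map, algebraMap_smul, ← h2, quantumDet, sub_smul, map_sub, sub_smul, map_mul,
    map_mul, mul_smul, mul_smul, mul_smul, mul_smul] at h1
  simp only [Module.End.smul_def, evalScalar_act, evalScalar_comp_X_sub_one, T22_smul_xi hβ,
    sub_left_inj, LinearMap.map_smul] at h1 ⊢
  rw [smul_comm] at h1
  exact smul_right_injective _ hu h1

end UniversalModule

/-! ### Diagonal and shift operators on the space with basis `ℤ^p`. -/

section ShiftOperators

variable {K : Type*} [Field K] {p : ℕ}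

/-- The space on which the model of the universal module is built. -/
def LatticeSpace (K : Type*) [Field K] (p : ℕ) : Type _ := (Fin p → ℤ) →₀ K

noncomputable instance : AddCommGroup (LatticeSpace K p) :=
  inferInstanceAs (AddCommGroup ((Fin p → ℤ) →₀ K))

noncomputable instance : Module K (LatticeSpace K p) :=
  inferInstanceAs (Module K ((Fin p → ℤ) →₀ K))

/-- The standard basis of the model. -/
noncomputable def latticeBasis (K : Type*) [Field K] (p : ℕ) :
    Module.Basis (Fin p → ℤ) K (LatticeSpace K p) :=
  Finsupp.basisSingleOne

/-- The basis vector with label `k`. -/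
noncomputable abbrev latticeVec (K : Type*) [Field K] {p : ℕ} (k : Fin p → ℤ) : LatticeSpace K p :=
  latticeBasis K p k

instance : Nontrivial (LatticeSpace K p) := ⟨⟨latticeVec K 0, 0, (latticeBasis K p).ne_zero 0⟩⟩

/-- Evaluation at a scalar of a polynomial whose coefficients are operators on the model. -/
noncomputable abbrev opEval (u : K) :
    (Module.End K (LatticeSpace K p))[X] →+* Module.End K (LatticeSpace K p) :=
  evalScalar u

theorem end_ext {f g : Module.End K (LatticeSpace K p)}
    (h : ∀ k, f (latticeVec K k) = g (latticeVec K k)) : f = g :=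
  (latticeBasis K p).ext h

/-- The polynomial of degree less than `N` whose coefficients are the operators with prescribed
values on the basis vectors. -/
noncomputable def opPoly (N : ℕ) (f : (Fin p → ℤ) → ℕ → LatticeSpace K p) :
    (Module.End K (LatticeSpace K p))[X] :=
  ∑ n ∈ Finset.range N, C ((latticeBasis K p).constr K fun k => f k n) * X ^ n

theorem coeff_opPoly (N : ℕ) (f : (Fin p → ℤ) → ℕ → LatticeSpace K p) (n : ℕ) (k : Fin p → ℤ) :
    (opPoly N f).coeff n (latticeVec K k) = if n < N then f k n else 0 := by
  unfold opPoly
  simp only [finsetSum_coeff, coeff_C_mul_X_pow, Finset.sum_ite_eq, Finset.mem_range]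
  split_ifs
  · rw [Module.Basis.constr_basis]
  · rfl

theorem degree_opPoly_lt (N : ℕ) (f : (Fin p → ℤ) → ℕ → LatticeSpace K p) :
    (opPoly N f).degree < (N : WithBot ℕ) := by
  rw [degree_lt_iff_coeff_zero]
  intro m hm
  refine end_ext fun k => ?_
  rw [coeff_opPoly, if_neg (by omega), LinearMap.zero_apply]

theorem evalScalar_opPoly (N : ℕ) (f : (Fin p → ℤ) → ℕ → LatticeSpace K p) (u : K)
    (k : Fin p → ℤ) :
    opEval u (opPoly N f) (latticeVec K k) = ∑ n ∈ Finset.range N, u ^ n • f k n := by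
  unfold opPoly
  rw [map_sum, LinearMap.sum_apply]
  refine Finset.sum_congr rfl fun n _ => ?_
  rw [map_mul, map_pow, opEval, evalScalar_C, evalScalar_X, ← map_pow, ← Algebra.commutes,
    ← Algebra.smul_def, LinearMap.smul_apply, Module.Basis.constr_basis]

/-- The diagonal operator polynomial `T_{22}(u)` of the model. -/
noncomputable def diagPoly (β : Fin p → K) : (Module.End K (LatticeSpace K p))[X] :=
  opPoly (p + 1) fun k n => (rootPoly β k).coeff n • latticeVec K k

/-- The operator polynomials that shift the labels of the basis vectors. -/
noncomputable def shiftOp (β : Fin p → K) (α : Fin p → (Fin p → ℤ) → K) (ε : ℤ) :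
    (Module.End K (LatticeSpace K p))[X] :=
  opPoly p fun k n => ∑ i, (α i k * (interp β i k).coeff n) • latticeVec K (k + Pi.single i ε)

theorem evalScalar_diagPoly (β : Fin p → K) (u : K) (k : Fin p → ℤ) :
    opEval u (diagPoly β) (latticeVec K k) = (rootPoly β k).eval u • latticeVec K k := by
  rw [diagPoly, evalScalar_opPoly, eval_eq_sum_range' (n := p + 1)
    (by rw [natDegree_rootPoly]; omega), Finset.sum_smul]
  refine Finset.sum_congr rfl fun n _ => ?_
  rw [smul_smul, mul_comm]

theorem monic_coPoly (β : Fin p → K) (i : Fin p) (k : Fin p → ℤ) : (coPoly β i k).Monic :=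
  monic_prod_of_monic _ _ fun _ _ => monic_X_add_C _

theorem natDegree_coPoly (β : Fin p → K) (i : Fin p) (k : Fin p → ℤ) :
    (coPoly β i k).natDegree = p - 1 := by
  unfold coPoly
  rw [natDegree_prod_of_monic _ _ fun _ _ => monic_X_add_C _]
  simp only [natDegree_X_add_C, Finset.sum_const, Finset.card_erase_of_mem (Finset.mem_univ i),
    Finset.card_univ, Fintype.card_fin, smul_eq_mul, mul_one]

theorem natDegree_interp_lt (β : Fin p → K) (i : Fin p) (k : Fin p → ℤ) :
    (interp β i k).natDegree < p := by
  have := i.pos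
  rw [interp_eq]
  refine (natDegree_C_mul_le _ _).trans_lt ?_
  rw [natDegree_coPoly]
  omega

theorem coeff_interp (β : Fin p → K) (i : Fin p) (k : Fin p → ℤ) :
    (interp β i k).coeff (p - 1) = coWeight β i k := by
  rw [interp_eq, coeff_C_mul, ← natDegree_coPoly β i k, (monic_coPoly β i k).coeff_natDegree,
    mul_one]

theorem evalScalar_shiftOp (β : Fin p → K) (α : Fin p → (Fin p → ℤ) → K) (ε : ℤ) (u : K)
    (k : Fin p → ℤ) :
    opEval u (shiftOp β α ε) (latticeVec K k)
      = ∑ i, (α i k * (interp β i k).eval u) • latticeVec K (k + Pi.single i ε) := by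
  rw [shiftOp, evalScalar_opPoly]
  simp only [Finset.smul_sum]
  rw [Finset.sum_comm]
  refine Finset.sum_congr rfl fun i _ => ?_
  rw [eval_eq_sum_range' (natDegree_interp_lt β i k), Finset.mul_sum, Finset.sum_smul]
  refine Finset.sum_congr rfl fun n _ => ?_
  rw [smul_smul]
  congr 1
  ring

theorem degree_shiftOp_lt (β : Fin p → K) (α : Fin p → (Fin p → ℤ) → K) (ε : ℤ) :
    (shiftOp β α ε).degree < (p : WithBot ℕ) := degree_opPoly_lt _ _

theorem natDegree_diagPoly_le (β : Fin p → K) : (diagPoly β).natDegree ≤ p := by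
  rw [natDegree_le_iff_degree_le, ← Order.lt_succ_iff]
  exact degree_opPoly_lt (p + 1) _

theorem coeff_diagPoly (β : Fin p → K) : (diagPoly β).coeff p = 1 := by
  refine end_ext fun k => ?_
  rw [diagPoly, coeff_opPoly, if_pos (by omega)]
  have := (monic_rootPoly β k).coeff_natDegree
  rw [natDegree_rootPoly] at this
  rw [this, one_smul, Module.End.one_apply]

theorem monic_diagPoly (β : Fin p → K) : (diagPoly β).Monic :=
  monic_of_natDegree_le_of_coeff_eq_one p (natDegree_diagPoly_le β) (coeff_diagPoly β)

theorem rootPoly_add_single_int (β : Fin p → K) (i : Fin p) (k : Fin p → ℤ) (ε : ℤ) :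
    rootPoly β (k + Pi.single i ε) = (X - C (root β k i - ε)) * coPoly β i k := by
  rw [rootPoly_eq β i, coPoly_congr β i (k' := k) fun j hj => by simp [hj]]
  congr 3
  simp [root]
  ring

/-- Holds term by term in the shifted label: `T_{22}` before and after the shift differs only in the
factor with root `root β k i`, and both sides reduce to the same multiple of `(v - u) * ε`, for any
coefficients `α`. -/
theorem diag_shift_relation (β : Fin p → K) (α : Fin p → (Fin p → ℤ) → K) (ε : ℤ)
    (u v : K) :
    (u - v) • (opEval u (shiftOp β α ε) * opEval v (diagPoly β)
        - opEval v (diagPoly β) * opEval u (shiftOp β α ε))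
      = (ε : K) • (opEval u (shiftOp β α ε) * opEval v (diagPoly β)
        - opEval v (shiftOp β α ε) * opEval u (diagPoly β)) := by
  refine end_ext fun k => ?_
  simp only [LinearMap.smul_apply, LinearMap.sub_apply, Module.End.mul_apply,
    evalScalar_diagPoly, LinearMap.map_smul, evalScalar_shiftOp, map_sum, Finset.smul_sum,
    ← Finset.sum_sub_distrib]
  refine Finset.sum_congr rfl fun i _ => ?_
  rw [rootPoly_eq β i k, rootPoly_add_single_int, interp_eq]
  simp only [eval_mul, eval_sub, eval_X, eval_C]
  module

theorem diag_shift_relation' (β : Fin p → K) (α : Fin p → (Fin p → ℤ) → K) (ε : ℤ)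
    (u v : K) :
    (u - v) • (opEval u (shiftOp β α ε) * opEval v (diagPoly β)
        - opEval v (diagPoly β) * opEval u (shiftOp β α ε))
      = (ε : K) • (opEval v (diagPoly β) * opEval u (shiftOp β α ε)
        - opEval u (diagPoly β) * opEval v (shiftOp β α ε)) := by
  refine end_ext fun k => ?_
  simp only [LinearMap.smul_apply, LinearMap.sub_apply, Module.End.mul_apply,
    evalScalar_diagPoly, LinearMap.map_smul, evalScalar_shiftOp, map_sum, Finset.smul_sum,
    ← Finset.sum_sub_distrib]
  refine Finset.sum_congr rfl fun i _ => ?_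
  rw [rootPoly_eq β i k, rootPoly_add_single_int, interp_eq]
  simp only [eval_mul, eval_sub, eval_X, eval_C]
  module

/-- The commutator of two operators given by interpolation, on a vector on which the
interpolation values at distinct nodes commute. -/
theorem commutator_apply {V : Type*} [AddCommGroup V] [Module K V] {s s' : Module.End K V}
    {l l' : Fin p → K} {x y : Fin p → Module.End K V} (hs : ∀ w, s w = ∑ i, l i • x i w)
    (hs' : ∀ w, s' w = ∑ i, l' i • y i w) {η : V}
    (h : ∀ i j, i ≠ j → x i (y j η) = y j (x i η)) :
    s (s' η) - s' (s η) = ∑ i, (l i * l' i) • (x i (y i η) - y i (x i η)) := by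
  have h1 : s (s' η) = ∑ i, ∑ j, (l i * l' j) • x i (y j η) := by
    rw [hs, hs']
    simp only [map_sum, LinearMap.map_smul, Finset.smul_sum, smul_smul]
  have h2 : s' (s η) = ∑ i, ∑ j, (l i * l' j) • y j (x i η) := by
    rw [Finset.sum_comm, hs', hs]
    simp only [map_sum, LinearMap.map_smul, Finset.smul_sum, smul_smul, mul_comm]
  rw [h1, h2, ← Finset.sum_sub_distrib]
  refine Finset.sum_congr rfl fun i _ => ?_
  rw [← Finset.sum_sub_distrib, Finset.sum_eq_single i]
  · rw [smul_sub]
  · intro j _ hj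
    rw [h i j hj.symm, sub_self]
  · simp

theorem evalScalar_root_shiftOp {β : Fin p → K}
    (hβ : ∀ i j : Fin p, i ≠ j → ∀ m : ℤ, β i - β j ≠ (m : K)) (α : Fin p → (Fin p → ℤ) → K)
    (ε : ℤ) (k : Fin p → ℤ) (i : Fin p) :
    opEval (root β k i) (shiftOp β α ε) (latticeVec K k)
      = α i k • latticeVec K (k + Pi.single i ε) := by
  rw [evalScalar_shiftOp, Finset.sum_eq_single i]
  · rw [interp_eq_basis, Lagrange.eval_basis_self (root_injective hβ k).injOn (Finset.mem_univ i),
      mul_one]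
  · intro j _ hj
    rw [interp_eq_basis, Lagrange.eval_basis_of_ne hj (Finset.mem_univ i), mul_zero, zero_smul]
  · simp

/-- The values of shift operators at distinct roots commute on basis vectors. -/
theorem shiftOp_roots_commute {β : Fin p → K}
    (hβ : ∀ i j : Fin p, i ≠ j → ∀ m : ℤ, β i - β j ≠ (m : K)) {α α' : Fin p → (Fin p → ℤ) → K}
    (hα : ∀ i k k', k i = k' i → α i k = α i k') (hα' : ∀ i k k', k i = k' i → α' i k = α' i k')
    (ε ε' : ℤ) (k : Fin p → ℤ) {i j : Fin p} (hij : i ≠ j) :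
    opEval (root β k i) (shiftOp β α ε)
        (opEval (root β k j) (shiftOp β α' ε') (latticeVec K k))
      = opEval (root β k j) (shiftOp β α' ε')
        (opEval (root β k i) (shiftOp β α ε) (latticeVec K k)) := by
  have e : ∀ {i j : Fin p} (ε : ℤ), i ≠ j → root β k i = root β (k + Pi.single j ε) i := by
    intro i j ε h
    simp [root, h]
  have h1 : α i (k + Pi.single j ε') = α i k := hα _ _ _ (by simp [hij])
  have h2 : α' j (k + Pi.single i ε) = α' j k := hα' _ _ _ (by simp [hij.symm])
  rw [evalScalar_root_shiftOp hβ, evalScalar_root_shiftOp hβ, LinearMap.map_smul,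
    LinearMap.map_smul, e ε' hij, evalScalar_root_shiftOp hβ, e ε hij.symm,
    evalScalar_root_shiftOp hβ, smul_smul, smul_smul, mul_comm, h1, h2,
    add_right_comm]

/-- The nodes are the roots at a fixed label `k`, whatever the vector `w`. This lets both factors of
a product acting on `latticeVec K k` be interpolated at the same nodes. -/
theorem evalScalar_shiftOp_apply {β : Fin p → K}
    (hβ : ∀ i j : Fin p, i ≠ j → ∀ m : ℤ, β i - β j ≠ (m : K)) (α : Fin p → (Fin p → ℤ) → K)
    (ε : ℤ) (k : Fin p → ℤ) (u : K) (w : LatticeSpace K p) :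
    opEval u (shiftOp β α ε) w
      = ∑ i, (interp β i k).eval u • opEval (root β k i) (shiftOp β α ε) w := by
  have := evalScalar_smul_eq_sum_basis (root_injective hβ k) (P := shiftOp β α ε)
    (by rw [Fintype.card_fin]; exact degree_shiftOp_lt β α ε) w u
  simp only [← interp_eq_basis] at this
  exact this

theorem coeff_shiftOp_apply {β : Fin p → K}
    (hβ : ∀ i j : Fin p, i ≠ j → ∀ m : ℤ, β i - β j ≠ (m : K)) (α : Fin p → (Fin p → ℤ) → K)
    (ε : ℤ) (k : Fin p → ℤ) (w : LatticeSpace K p) :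
    (shiftOp β α ε).coeff (p - 1) w
      = ∑ i, coWeight β i k • opEval (root β k i) (shiftOp β α ε) w := by
  have := coeff_smul_eq_sum_basis (root_injective hβ k) (P := shiftOp β α ε)
    (by rw [Fintype.card_fin]; exact degree_shiftOp_lt β α ε) w (p - 1)
  simp only [← interp_eq_basis, coeff_interp] at this
  exact this

/-- At distinct nodes the values commute, and at equal nodes they are the same operator, so every
term of `commutator_apply` vanishes. -/
theorem shiftOp_commute_self {β : Fin p → K}
    (hβ : ∀ i j : Fin p, i ≠ j → ∀ m : ℤ, β i - β j ≠ (m : K)) {α : Fin p → (Fin p → ℤ) → K}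
    (hα : ∀ i k k', k i = k' i → α i k = α i k') (ε : ℤ) (u v : K) :
    opEval u (shiftOp β α ε) * opEval v (shiftOp β α ε)
      = opEval v (shiftOp β α ε) * opEval u (shiftOp β α ε) := by
  refine end_ext fun k => ?_
  rw [← sub_eq_zero, Module.End.mul_apply, Module.End.mul_apply,
    commutator_apply (evalScalar_shiftOp_apply hβ α ε k u) (evalScalar_shiftOp_apply hβ α ε k v)
      fun i j hij => shiftOp_roots_commute hβ hα hα ε ε k hij]
  simp

end ShiftOperators

/-! ### The matrix of operators of the model. -/

section Model

variable {K : Type*} [Field K] {p : ℕ} (β : Fin p → K) (γ : Fin (2 * p) → K)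

/-- The operator polynomial `T_{21}(u)` of the model. -/
noncomputable def lowerPoly : (Module.End K (LatticeSpace K p))[X] :=
  shiftOp β (LevelYangian.A β γ) 1

/-- The operator polynomial `T_{12}(u)` of the model. -/
noncomputable def upperPoly : (Module.End K (LatticeSpace K p))[X] :=
  shiftOp β (LevelYangian.B β γ) (-1)

/-- The operator polynomial `T_{11}(u) = T_{22}(u) - [t_{21}^{(1)}, T_{12}(u)]` of the model. -/
noncomputable def topPoly : (Module.End K (LatticeSpace K p))[X] :=
  -- This choice is forced by the coefficient of `u^p` in `(u - v)[T_{21}(u), T_{12}(v)] = T_{11}(u)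
  -- T_{22}(v) - T_{11}(v) T_{22}(u)`.
  diagPoly β - (C ((lowerPoly β γ).coeff (p - 1)) * upperPoly β γ
    - upperPoly β γ * C ((lowerPoly β γ).coeff (p - 1)))

/-- The matrix of operator polynomials of the model. -/
noncomputable def modelT : Fin 2 → Fin 2 → (Module.End K (LatticeSpace K p))[X] :=
  !![topPoly β γ, upperPoly β γ; lowerPoly β γ, diagPoly β]

variable {β γ}

theorem A_congr (i : Fin p) (k k' : Fin p → ℤ) (h : k i = k' i) :
    LevelYangian.A β γ i k = LevelYangian.A β γ i k' := by
  unfold LevelYangian.A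
  rw [h]

theorem B_congr (i : Fin p) (k k' : Fin p → ℤ) (h : k i = k' i) :
    LevelYangian.B β γ i k = LevelYangian.B β γ i k' := by
  unfold LevelYangian.B
  rw [h]

theorem lowerPoly_root_smul (hβ : ∀ i j : Fin p, i ≠ j → ∀ m : ℤ, β i - β j ≠ (m : K))
    (k : Fin p → ℤ) (i : Fin p) :
    opEval (root β k i) (lowerPoly β γ) (latticeVec K k)
      = LevelYangian.A β γ i k • latticeVec K (k + Pi.single i 1) :=
  evalScalar_root_shiftOp hβ _ _ _ _

theorem upperPoly_root_smul (hβ : ∀ i j : Fin p, i ≠ j → ∀ m : ℤ, β i - β j ≠ (m : K))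
    (k : Fin p → ℤ) (i : Fin p) :
    opEval (root β k i) (upperPoly β γ) (latticeVec K k)
      = LevelYangian.B β γ i k • latticeVec K (k - Pi.single i 1) := by
  rw [sub_eq_add_neg, ← Pi.single_neg]
  exact evalScalar_root_shiftOp hβ _ _ _ _

/-- The product of the coefficients of opposite shifts. -/
theorem A_mul_B (i : Fin p) (k : Fin p → ℤ) :
    LevelYangian.A β γ i k * LevelYangian.B β γ i (k + Pi.single i 1)
      = -(shiftPoly γ).eval (root β k i) := by
  unfold LevelYangian.A LevelYangian.B
  simp only [Pi.add_apply, Pi.single_eq_same]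
  -- Of a shift and its inverse, exactly the one directed towards label `0` carries the factor `-γ`.
  by_cases h : 0 ≤ k i
  · rw [if_pos h, if_pos (by omega), one_mul, root]
    congr 2
    push_cast
    ring
  · rw [if_neg h, if_neg (by omega), mul_one, root]

/-- The commutator of the values of the off-diagonal entries at the same root. -/
noncomputable def rootCommutator (β : Fin p → K) (γ : Fin (2 * p) → K) (k : Fin p → ℤ)
    (i : Fin p) : LatticeSpace K p :=
  opEval (root β k i) (lowerPoly β γ) (opEval (root β k i) (upperPoly β γ) (latticeVec K k))
    - opEval (root β k i) (upperPoly β γ) (opEval (root β k i) (lowerPoly β γ) (latticeVec K k))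

theorem lower_upper_commutator (hβ : ∀ i j : Fin p, i ≠ j → ∀ m : ℤ, β i - β j ≠ (m : K))
    (u v : K) (k : Fin p → ℤ) :
    opEval u (lowerPoly β γ) (opEval v (upperPoly β γ) (latticeVec K k))
      - opEval v (upperPoly β γ) (opEval u (lowerPoly β γ) (latticeVec K k))
      = ∑ i, ((interp β i k).eval u * (interp β i k).eval v) • rootCommutator β γ k i :=
  commutator_apply (evalScalar_shiftOp_apply hβ _ _ k u) (evalScalar_shiftOp_apply hβ _ _ k v)
    fun _ _ hij => shiftOp_roots_commute hβ A_congr B_congr _ _ k hij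

theorem topPoly_apply (hβ : ∀ i j : Fin p, i ≠ j → ∀ m : ℤ, β i - β j ≠ (m : K))
    (v : K) (k : Fin p → ℤ) :
    opEval v (topPoly β γ) (latticeVec K k) = (rootPoly β k).eval v • latticeVec K k
      - ∑ i, (coWeight β i k * (interp β i k).eval v) • rootCommutator β γ k i := by
  rw [topPoly, map_sub, map_sub, map_mul, map_mul, opEval, evalScalar_C, LinearMap.sub_apply,
    evalScalar_diagPoly]
  congr 1
  exact commutator_apply (coeff_shiftOp_apply hβ _ _ k) (evalScalar_shiftOp_apply hβ _ _ k v)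
    fun _ _ hij => shiftOp_roots_commute hβ A_congr B_congr _ _ k hij

/-- The expansion in `lower_upper_commutator` is visibly symmetric in `u` and `v`. -/
theorem lower_upper_symm (hβ : ∀ i j : Fin p, i ≠ j → ∀ m : ℤ, β i - β j ≠ (m : K)) (u v : K) :
    opEval u (lowerPoly β γ) * opEval v (upperPoly β γ)
        - opEval v (upperPoly β γ) * opEval u (lowerPoly β γ)
      = opEval v (lowerPoly β γ) * opEval u (upperPoly β γ)
        - opEval u (upperPoly β γ) * opEval v (lowerPoly β γ) := by
  refine end_ext fun k => ?_
  simp only [LinearMap.sub_apply, Module.End.mul_apply]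
  rw [lower_upper_commutator hβ, lower_upper_commutator hβ]
  simp only [mul_comm]

/-- On a basis vector the diagonal parts of `topPoly` cancel. In the `i`-th remaining term, with `x`
the `i`-th root, the factor that appears is `(u - x) - (v - x) = u - v`. -/
theorem lower_upper_relation (hβ : ∀ i j : Fin p, i ≠ j → ∀ m : ℤ, β i - β j ≠ (m : K))
    (u v : K) :
    (u - v) • (opEval u (lowerPoly β γ) * opEval v (upperPoly β γ)
        - opEval v (upperPoly β γ) * opEval u (lowerPoly β γ))
      = opEval u (topPoly β γ) * opEval v (diagPoly β)
        - opEval v (topPoly β γ) * opEval u (diagPoly β) := by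
  refine end_ext fun k => ?_
  simp only [LinearMap.smul_apply, LinearMap.sub_apply, Module.End.mul_apply]
  rw [lower_upper_commutator hβ, evalScalar_diagPoly, evalScalar_diagPoly, LinearMap.map_smul,
    LinearMap.map_smul, topPoly_apply hβ, topPoly_apply hβ, smul_sub, smul_sub, smul_comm,
    sub_sub_sub_cancel_left, Finset.smul_sum, Finset.smul_sum, Finset.smul_sum,
    ← Finset.sum_sub_distrib]
  refine Finset.sum_congr rfl fun i _ => ?_
  rw [rootPoly_eq β i k, interp_eq]
  simp only [eval_mul, eval_sub, eval_X, eval_C]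
  module

theorem natDegree_lt_of_degree_lt {R : Type*} [Ring R] {P : R[X]} {n : ℕ} (hn : 0 < n)
    (h : P.degree < (n : WithBot ℕ)) : P.natDegree < n := by
  by_cases hP : P = 0
  · simpa [hP]
  · exact (natDegree_lt_iff_degree_lt hP).2 h

theorem natDegree_upperPoly_lt (hp : 0 < p) : (upperPoly β γ).natDegree < p :=
  natDegree_lt_of_degree_lt hp (degree_shiftOp_lt _ _ _)

theorem natDegree_lowerPoly_lt (hp : 0 < p) : (lowerPoly β γ).natDegree < p :=
  natDegree_lt_of_degree_lt hp (degree_shiftOp_lt _ _ _)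

theorem natDegree_diagPoly : (diagPoly β).natDegree = p := by
  refine le_antisymm (natDegree_diagPoly_le β) (le_natDegree_of_ne_zero ?_)
  rw [coeff_diagPoly]
  exact one_ne_zero

theorem natDegree_top_sub_diag_lt (hp : 0 < p) : (C ((lowerPoly β γ).coeff (p - 1)) * upperPoly β γ
    - upperPoly β γ * C ((lowerPoly β γ).coeff (p - 1))).natDegree < p := by
  refine (natDegree_sub_le _ _).trans_lt (max_lt ?_ ?_)
  · exact (natDegree_C_mul_le _ _).trans_lt (natDegree_upperPoly_lt hp)
  · exact (natDegree_mul_C_le _ _).trans_lt (natDegree_upperPoly_lt hp)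

theorem monic_topPoly (hp : 0 < p) : (topPoly β γ).Monic := by
  refine (monic_diagPoly β).sub_of_left (degree_lt_degree ?_)
  rw [natDegree_diagPoly]
  exact natDegree_top_sub_diag_lt hp

theorem natDegree_topPoly (hp : 0 < p) : (topPoly β γ).natDegree = p := by
  rw [topPoly, natDegree_sub_eq_left_of_natDegree_lt, natDegree_diagPoly]
  rw [natDegree_diagPoly]
  exact natDegree_top_sub_diag_lt hp

end Model

/-! ### The determinant relation and the RTT relations in the model. -/

section ModelRelations

variable {K : Type*} [Field K] {p : ℕ} {β : Fin p → K} {γ : Fin (2 * p) → K}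

theorem natDegree_shiftPoly {n : ℕ} (a : Fin n → K) : (shiftPoly a).natDegree = n := by
  unfold shiftPoly
  rw [natDegree_prod_of_monic _ _ fun _ _ => monic_X_add_C _]
  simp only [natDegree_X_add_C, Finset.sum_const, Finset.card_univ, Fintype.card_fin,
    smul_eq_mul, mul_one]

theorem monic_shiftPoly {n : ℕ} (a : Fin n → K) : (shiftPoly a).Monic :=
  monic_prod_of_monic _ _ fun _ _ => monic_X_add_C _

theorem natDegree_comp_X_sub_one_le {R : Type*} [Ring R] (P : R[X]) :
    (P.comp (X - 1)).natDegree ≤ P.natDegree := by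
  refine natDegree_comp_le.trans ?_
  have : (X - 1 : R[X]).natDegree ≤ 1 := by simpa using natDegree_X_sub_C_le (1 : R)
  simpa using Nat.mul_le_mul_left P.natDegree this

/-- The defect of the quantum determinant relation. -/
noncomputable def detDefect (β : Fin p → K) (γ : Fin (2 * p) → K) :
    (Module.End K (LatticeSpace K p))[X] :=
  topPoly β γ * (diagPoly β).comp (X - 1) - lowerPoly β γ * (upperPoly β γ).comp (X - 1)
    - (shiftPoly γ).map (algebraMap K _)

/-- The product of the diagonal entries and `γ` are both monic of degree `2p`, and the off-diagonal
product has smaller degree. -/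
theorem degree_detDefect_lt (hp : 0 < p) :
    (detDefect β γ).degree < ((2 * p : ℕ) : WithBot ℕ) := by
  have hd := monic_comp_X_sub_one (monic_diagPoly β)
  have hd' : ((diagPoly β).comp (X - 1)).natDegree ≤ p :=
    (natDegree_comp_X_sub_one_le _).trans natDegree_diagPoly.le
  have hm := (monic_topPoly (β := β) (γ := γ) hp).mul hd
  have hn : (topPoly β γ * (diagPoly β).comp (X - 1)).natDegree ≤ 2 * p := by
    refine natDegree_mul_le.trans ?_
    rw [natDegree_topPoly hp]
    omega
  have hl : (lowerPoly β γ * (upperPoly β γ).comp (X - 1)).natDegree < 2 * p := by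
    refine natDegree_mul_le.trans_lt ?_
    have h1 := natDegree_lowerPoly_lt (β := β) (γ := γ) hp
    have h2 := natDegree_upperPoly_lt (β := β) (γ := γ) hp
    have h3 := natDegree_comp_X_sub_one_le (upperPoly β γ)
    omega
  have e1 : (topPoly β γ * (diagPoly β).comp (X - 1)).coeff (2 * p) = 1 := by
    have hd1 : ((diagPoly β).comp (X - 1)).natDegree = p := by
      have h1 : (X - 1 : (Module.End K (LatticeSpace K p))[X]) = X - C 1 := by rw [map_one]
      rw [h1, natDegree_comp_eq_of_mul_ne_zero, natDegree_X_sub_C, mul_one, natDegree_diagPoly]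
      rw [(monic_diagPoly β).leadingCoeff, leadingCoeff_X_sub_C, one_pow, one_mul]
      exact one_ne_zero
    have := hm.coeff_natDegree
    rwa [(monic_topPoly hp).natDegree_mul hd, natDegree_topPoly hp, hd1, ← two_mul] at this
  have e2 : (shiftPoly γ).coeff (2 * p) = 1 := by
    have := (monic_shiftPoly γ).coeff_natDegree
    rwa [natDegree_shiftPoly] at this
  rw [degree_lt_iff_coeff_zero]
  intro m hm
  rw [detDefect, coeff_sub, coeff_sub, coeff_eq_zero_of_natDegree_lt (hl.trans_le hm), sub_zero,
    coeff_map]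
  rcases hm.eq_or_lt with rfl | hm
  · rw [e1, e2, map_one, sub_self]
  · rw [coeff_eq_zero_of_natDegree_lt (hn.trans_lt hm),
      coeff_eq_zero_of_natDegree_lt (by rwa [natDegree_shiftPoly]), map_zero, sub_zero]

theorem opEval_detDefect (u : K) :
    opEval u (detDefect β γ) = opEval u (topPoly β γ) * opEval (u - 1) (diagPoly β)
      - opEval u (lowerPoly β γ) * opEval (u - 1) (upperPoly β γ)
      - algebraMap K _ ((shiftPoly γ).eval u) := by
  rw [detDefect, map_sub, map_sub, map_mul, map_mul, opEval, evalScalar_comp_X_sub_one,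
    evalScalar_comp_X_sub_one, evalScalar_map]

theorem detDefect_root (hβ : ∀ i j : Fin p, i ≠ j → ∀ m : ℤ, β i - β j ≠ (m : K))
    (k : Fin p → ℤ) (i : Fin p) :
    opEval (root β k i) (detDefect β γ) (latticeVec K k) = 0 := by
  -- This moves the shift by one so that `T_{22}` is evaluated at the root itself and its product
  -- vanishes; the other product is a step forward and back, computed by `A_mul_B`.
  have h := lower_upper_relation (γ := γ) hβ (root β k i) (root β k i - 1)
  rw [sub_sub_cancel, one_smul, sub_eq_sub_iff_add_eq_add] at h
  have h' : opEval (root β k i) (detDefect β γ)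
      = opEval (root β k i - 1) (topPoly β γ) * opEval (root β k i) (diagPoly β)
      - opEval (root β k i - 1) (upperPoly β γ) * opEval (root β k i) (lowerPoly β γ)
      - algebraMap K _ ((shiftPoly γ).eval (root β k i)) := by
    rw [opEval_detDefect, sub_left_inj, sub_eq_sub_iff_add_eq_add, ← h, add_comm]
  have e := upperPoly_root_smul (γ := γ) hβ (k + Pi.single i 1) i
  rw [root_add_single_self, add_sub_cancel_right] at e
  rw [h', LinearMap.sub_apply, LinearMap.sub_apply, Module.End.mul_apply, Module.End.mul_apply,
    evalScalar_diagPoly, rootPoly_eval_root, zero_smul, map_zero, zero_sub,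
    lowerPoly_root_smul hβ, LinearMap.map_smul, e, smul_smul, A_mul_B,
    Module.algebraMap_end_apply, neg_smul, neg_neg, sub_self]

theorem detDefect_root_add_one (hβ : ∀ i j : Fin p, i ≠ j → ∀ m : ℤ, β i - β j ≠ (m : K))
    (k : Fin p → ℤ) (i : Fin p) :
    opEval (root β k i + 1) (detDefect β γ) (latticeVec K k) = 0 := by
  have e := lowerPoly_root_smul (γ := γ) hβ (k - Pi.single i 1) i
  have e' := A_mul_B (β := β) (γ := γ) i (k - Pi.single i 1)
  rw [root_sub_single_self, sub_add_cancel] at e e'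
  rw [opEval_detDefect, add_sub_cancel_right, LinearMap.sub_apply, LinearMap.sub_apply,
    Module.End.mul_apply, Module.End.mul_apply,
    evalScalar_diagPoly, rootPoly_eval_root, zero_smul, map_zero, zero_sub,
    upperPoly_root_smul hβ, LinearMap.map_smul, e, smul_smul, mul_comm, e',
    Module.algebraMap_end_apply, neg_smul, neg_neg, sub_self]

theorem opEval_detDefect_eq_zero (hp : 0 < p)
    (hβ : ∀ i j : Fin p, i ≠ j → ∀ m : ℤ, β i - β j ≠ (m : K)) (u : K) :
    opEval u (detDefect β γ) = 0 := by
  refine end_ext fun k => ?_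
  -- The `2p` nodes are the roots and the roots plus one; a coincidence between different indices
  -- would make some `β i - β j` an integer.
  have hinj : Function.Injective
      (Sum.elim (root β k) fun i => root β k i + 1 : Fin p ⊕ Fin p → K) := by
    refine (root_injective hβ k).sumElim (fun i j h => root_injective hβ k (add_right_cancel h))
      fun i j h => ?_
    rcases eq_or_ne i j with rfl | hij
    · simp at h
    · exact root_sub_root_ne hβ k k hij 1 (by rw [h]; simp)
  have := evalScalar_smul_eq_sum_basis hinj (P := detDefect β γ)
    (by
      rw [Fintype.card_sum, Fintype.card_fin, ← two_mul]
      exact degree_detDefect_lt hp) (latticeVec K k) u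
  refine this.trans (Finset.sum_eq_zero fun i _ => ?_)
  refine (congrArg _ ?_).trans (smul_zero _)
  rcases i with i | i
  · exact detDefect_root hβ k i
  · exact detDefect_root_add_one hβ k i

theorem isRTT_model [CharZero K] (hp : 0 < p)
    (hβ : ∀ i j : Fin p, i ≠ j → ∀ m : ℤ, β i - β j ≠ (m : K)) :
    IsRTT fun i j (u : K) => opEval u (modelT β γ i j) := by
  have hc := fun u v => diag_shift_relation β (LevelYangian.A β γ) 1 u v
  have hc' := fun u v => diag_shift_relation' β (LevelYangian.A β γ) 1 u v
  have hb := fun u v => diag_shift_relation β (LevelYangian.B β γ) (-1) u v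
  have hb' := fun u v => diag_shift_relation' β (LevelYangian.B β γ) (-1) u v
  simp only [Int.cast_one, Int.cast_neg, one_smul] at hc hc' hb hb'
  refine isRTT_of_quantumDet (T := modelT β γ) (monic_diagPoly β) (fun _ _ _ => rfl) ?_
    (shiftOp_commute_self hβ A_congr 1) (shiftOp_commute_self hβ B_congr (-1)) hc ?_ ?_ ?_
    (lower_upper_relation hβ) (lower_upper_symm hβ) (fun u => (shiftPoly γ).eval u) ?_
  · intro u v
    refine end_ext fun k => ?_
    change opEval u (diagPoly β) (opEval v (diagPoly β) _)
      = opEval v (diagPoly β) (opEval u (diagPoly β) _)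
    rw [evalScalar_diagPoly, evalScalar_diagPoly, LinearMap.map_smul, LinearMap.map_smul,
      evalScalar_diagPoly, evalScalar_diagPoly, smul_comm]
  · intro u v
    change (u - v) • (opEval u (diagPoly β) * opEval v (lowerPoly β γ)
      - opEval v (lowerPoly β γ) * opEval u (diagPoly β))
      = opEval u (diagPoly β) * opEval v (lowerPoly β γ)
        - opEval v (diagPoly β) * opEval u (lowerPoly β γ)
    refine Eq.trans ?_ (hc' v u)
    rw [lowerPoly]
    module
  · intro u v
    change (u - v) • (opEval u (upperPoly β γ) * opEval v (diagPoly β)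
      - opEval v (diagPoly β) * opEval u (upperPoly β γ))
      = opEval u (diagPoly β) * opEval v (upperPoly β γ)
        - opEval v (diagPoly β) * opEval u (upperPoly β γ)
    refine (hb' u v).trans ?_
    rw [upperPoly]
    module
  · intro u v
    change (u - v) • (opEval u (diagPoly β) * opEval v (upperPoly β γ)
      - opEval v (upperPoly β γ) * opEval u (diagPoly β))
      = opEval u (upperPoly β γ) * opEval v (diagPoly β)
        - opEval v (upperPoly β γ) * opEval u (diagPoly β)
    rw [upperPoly]
    linear_combination (norm := module) hb v u
  · intro u
    have := opEval_detDefect_eq_zero (γ := γ) hp hβ u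
    rw [opEval_detDefect, sub_eq_zero] at this
    exact this

end ModelRelations

/-! ### The representation on the model and linear independence. -/

section Representation

variable {K : Type*} [Field K] {p : ℕ} {β : Fin p → K} {γ : Fin (2 * p) → K}

/-- The operators through which the generators of the Yangian act on the model. -/
noncomputable def modelGen (β : Fin p → K) (γ : Fin (2 * p) → K) (i j : Fin 2) (r : ℕ) :
    Module.End K (LatticeSpace K p) :=
  if r ≤ p then (modelT β γ i j).coeff (p - r) else 0

theorem natDegree_modelT_le (hp : 0 < p) (i j : Fin 2) : (modelT β γ i j).natDegree ≤ p := by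
  fin_cases i <;> fin_cases j
  · exact (natDegree_topPoly hp).le
  · exact (natDegree_upperPoly_lt hp).le
  · exact (natDegree_lowerPoly_lt hp).le
  · exact natDegree_diagPoly.le

theorem modelGen_zero (hp : 0 < p) (i j : Fin 2) :
    modelGen β γ i j 0 = if i = j then 1 else 0 := by
  unfold modelGen
  rw [if_pos (Nat.zero_le p), Nat.sub_zero]
  fin_cases i <;> fin_cases j
  · have := (monic_topPoly (β := β) (γ := γ) hp).coeff_natDegree
    rwa [natDegree_topPoly hp] at this
  · exact coeff_eq_zero_of_natDegree_lt (natDegree_upperPoly_lt hp)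
  · exact coeff_eq_zero_of_natDegree_lt (natDegree_lowerPoly_lt hp)
  · exact coeff_diagPoly β

theorem genSum_modelGen (hp : 0 < p) (i j : Fin 2) (u : K) :
    genSum p (modelGen β γ) i j u = opEval u (modelT β γ i j) := by
  unfold genSum
  rw [opEval, evalScalar_apply, eval_eq_sum_range' (n := p + 1)
    (by have := natDegree_modelT_le (β := β) (γ := γ) hp i j; omega),
    ← Finset.sum_range_reflect]
  refine Finset.sum_congr rfl fun r hr => ?_
  have := Finset.mem_range.1 hr
  rw [modelGen, if_pos (by omega), ← map_pow, ← Algebra.commutes, Algebra.smul_def]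
  congr 3 <;> omega

theorem isCommutatorRTT_modelGen [CharZero K] (hp : 0 < p)
    (hβ : ∀ i j : Fin p, i ≠ j → ∀ m : ℤ, β i - β j ≠ (m : K)) :
    IsCommutatorRTT (modelGen β γ) := by
  have h0 : ∀ i j x, modelGen β γ i j 0 * x = x * modelGen β γ i j 0 := by
    intro i j x
    rw [modelGen_zero hp]
    split_ifs <;> simp
  refine (IsRTT.isDifferenceRTT (K := K) (p := p) ?_ h0 fun i j r hr => ?_).isCommutatorRTT h0
  · have := isRTT_model (γ := γ) hp hβ
    intro i j k l u v
    simp only [genSum_modelGen hp]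
    exact this i j k l u v
  · rw [modelGen, if_neg (by omega)]

/-- The model carries a representation of the Yangian. -/
theorem exists_model_representation [CharZero K] (hp : 0 < p)
    (hβ : ∀ i j : Fin p, i ≠ j → ∀ m : ℤ, β i - β j ≠ (m : K)) :
    ∃ ρ : Yangian K p →ₐ[K] Module.End K (LatticeSpace K p),
      ∀ i j (u : K), ρ (evalScalar u (T K p i j)) = opEval u (modelT β γ i j) := by
  let φ : FreeAlgebra K (Fin 2 × Fin 2 × Fin p) →ₐ[K] Module.End K (LatticeSpace K p) :=
    FreeAlgebra.lift K fun x => modelGen β γ x.1 x.2.1 (x.2.2 + 1)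
  have hφ : ∀ i j r, φ (freeGen K p i j r) = modelGen β γ i j r := by
    intro i j r
    rcases r with _ | r
    · rw [modelGen_zero hp]
      unfold freeGen
      split_ifs <;> simp
    · unfold freeGen
      simp only
      split_ifs with h
      · simp [φ]
      · rw [map_zero, modelGen, if_neg (by omega)]
  have hrel : ∀ ⦃x y⦄, Rel K p x y → φ x = φ y := by
    rintro _ _ ⟨i, j, k, l, r, s, hr, hs⟩
    rw [sum_Icc_one_eq_sum_range]
    simp only [map_sub, map_mul, map_sum, hφ, Nat.add_sub_cancel]
    exact isCommutatorRTT_modelGen hp hβ i j k l r s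
  let ρ : Yangian K p →ₐ[K] Module.End K (LatticeSpace K p) := RingQuot.liftAlgHom K ⟨φ, hrel⟩
  have hρ : ∀ i j r, ρ (t K p i j r) = modelGen β γ i j r := fun i j r =>
    (RingQuot.liftAlgHom_mkAlgHom_apply K φ hrel _).trans (hφ i j r)
  refine ⟨ρ, fun i j u => ?_⟩
  rw [evalScalar_T, ← genSum_modelGen hp, genSum, genSum, map_sum]
  refine Finset.sum_congr rfl fun r _ => ?_
  rw [map_smul, hρ]

/-- The universal module maps to the model. -/
theorem exists_map_to_model [CharZero K] (hp : 0 < p)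
    (hβ : ∀ i j : Fin p, i ≠ j → ∀ m : ℤ, β i - β j ≠ (m : K)) :
    ∃ f : UniversalModule β γ →ₗ[K] LatticeSpace K p, ∀ k, f (xi β γ k) = latticeVec K k := by
  obtain ⟨ρ, hρ⟩ := exists_model_representation (γ := γ) hp hβ
  -- With the model as a Yangian module, the map from `M(ℓ)` sends `1` to the basis vector of label
  -- `0`; it exists once the generators of the left ideal kill that vector.
  let _ : Module (Yangian K p) (LatticeSpace K p) := Module.compHom _ ρ.toRingHom
  have hsmul : ∀ (y : Yangian K p) (w : LatticeSpace K p), y • w = ρ y w := fun _ _ => rfl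
  have : IsScalarTower K (Yangian K p) (LatticeSpace K p) := ⟨fun c y w => by
    rw [hsmul, hsmul, map_smul, LinearMap.smul_apply]⟩
  have hI : leftIdeal β γ ≤
      LinearMap.ker (LinearMap.toSpanSingleton (Yangian K p) _ (latticeVec K (0 : Fin p → ℤ))) := by
    have key : ∀ (P : (Yangian K p)[X]) (q : K[X]), (∀ u : K, evalScalar u P • latticeVec K 0
        = q.eval u • latticeVec K (0 : Fin p → ℤ)) → ∀ n,
        (P - q.map (algebraMap K (Yangian K p))).coeff n • latticeVec K (0 : Fin p → ℤ) = 0 := by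
      intro P q h n
      have := coeff_smul_eq (K := K) (P := P) (Q := q.map (algebraMap K (Yangian K p)))
        (η := latticeVec K (0 : Fin p → ℤ)) (ζ := latticeVec K (0 : Fin p → ℤ)) Set.finite_empty
        (fun u _ => by rw [h, evalScalar_map, algebraMap_smul]) n
      rw [coeff_sub, sub_smul, this, sub_self]
    refine Submodule.span_le.2 (Set.union_subset ?_ ?_)
    · rintro _ ⟨n, rfl⟩
      refine key (T K p 1 1) (shiftPoly β) (fun u => ?_) n
      rw [hsmul, hρ]
      refine (evalScalar_diagPoly β u 0).trans ?_
      simp [rootPoly, shiftPoly]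
    · rintro _ ⟨n, rfl⟩
      refine key (D K p) (shiftPoly γ) (fun u => ?_) n
      have h0 := opEval_detDefect_eq_zero (γ := γ) hp hβ u
      rw [opEval_detDefect, sub_eq_zero] at h0
      rw [hsmul, evalScalar_D, quantumDet, map_sub, map_mul, map_mul, hρ, hρ, hρ, hρ]
      refine (DFunLike.congr_fun h0 _).trans ?_
      rw [Module.algebraMap_end_apply]
  let f : UniversalModule β γ →ₗ[Yangian K p] LatticeSpace K p :=
    (leftIdeal β γ).liftQ _ hI
  refine ⟨f.restrictScalars K, fun k => ?_⟩
  change f (xi β γ k) = latticeVec K k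
  -- The induction only moves labels away from `0`, where the coefficients `A` and `B` equal `1`, so
  -- no scalars accumulate.
  induction k using lattice_induction with
  | h0 =>
    rw [xi_zero]
    exact (Submodule.liftQ_apply _ _ _).trans (one_smul _ _)
  | hneg k i hk ih =>
    rw [(xi_eigen_and_sub_single hβ k).2 i (hk i), map_smul, ih, hsmul, hρ]
    refine (upperPoly_root_smul hβ k i).trans ?_
    rw [LevelYangian.B, if_neg (by have := hk i; omega), one_smul]
  | hpos k i hi ih =>
    rw [xi_add_single hi, map_smul, ih, hsmul, hρ]
    refine (lowerPoly_root_smul hβ k i).trans ?_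
    rw [LevelYangian.A, if_pos hi, one_smul]

theorem linearIndependent_xi [CharZero K] (hp : 0 < p)
    (hβ : ∀ i j : Fin p, i ≠ j → ∀ m : ℤ, β i - β j ≠ (m : K)) :
    LinearIndependent K (xi β γ) := by
  obtain ⟨f, hf⟩ := exists_map_to_model (γ := γ) hp hβ
  refine LinearIndependent.of_comp f ?_
  have : f ∘ xi β γ = latticeBasis K p := funext hf
  rw [this]
  exact (latticeBasis K p).linearIndependent

end Representation

end LevelYangian

/-- Identities between polynomials in `u` with coefficients in `M(ℓ)` are stated coefficient by
coefficient. -/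
theorem theorem3 {K : Type*} [Field K] [IsAlgClosed K] [CharZero K] (p : ℕ) (hp : 0 < p)
    (β : Fin p → K) (γ : Fin (2 * p) → K)
    (hβ : ∀ i j : Fin p, i ≠ j → ∀ m : ℤ, β i - β j ≠ (m : K)) :
    -- the vectors `ξ^{(k)}` form a basis of `M(ℓ)`
    (∃ b : Module.Basis (Fin p → ℤ) K (UniversalModule β γ), ∀ k, b k = xi β γ k) ∧
    -- the action of `T_{22}(u)`
    (∀ (k : Fin p → ℤ) (n : ℕ),
      (T₂₂ K p).coeff n • xi β γ k
        = (∏ i, (X + C (β i + (k i : K)))).coeff n • xi β γ k) ∧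
    -- the action of `T_{21}(u)`
    (∀ (k : Fin p → ℤ) (n : ℕ),
      (T₂₁ K p).coeff n • xi β γ k
        = ∑ i, (A β γ i k * (interp β i k).coeff n) • xi β γ (k + Pi.single i 1)) ∧
    -- the action of `T_{12}(u)`
    (∀ (k : Fin p → ℤ) (n : ℕ),
      (T₁₂ K p).coeff n • xi β γ k
        = ∑ i, (B β γ i k * (interp β i k).coeff n) • xi β γ (k - Pi.single i 1)) ∧
    -- the relation for the action of `T_{11}(u)`
    (∀ (k : Fin p → ℤ) (n : ℕ),
      (T₁₁ K p * (T₂₂ K p).comp (X - 1) - T₂₁ K p * (T₁₂ K p).comp (X - 1)).coeff n • xi β γ k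
        = (shiftPoly γ).coeff n • xi β γ k) ∧
    -- this relation determines the action of `T_{11}(u)`
    (∀ F : (Module.End K (UniversalModule β γ))[X],
      (∀ (k : Fin p → ℤ) (n : ℕ),
        (F * act β γ ((T₂₂ K p).comp (X - 1))
            - act β γ (T₂₁ K p) * act β γ ((T₁₂ K p).comp (X - 1))).coeff n (xi β γ k)
          = (shiftPoly γ).coeff n • xi β γ k) →
      F = act β γ (T₁₁ K p)) := by
  refine ⟨?_, fun k n => coeff_T22_smul_xi hβ k n, fun k n => coeff_T21_smul_xi hβ k n,
    fun k n => coeff_T12_smul_xi hβ k n, fun k n => coeff_D_smul_xi hβ k n,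
    fun F hF => eq_act_T11 hβ F hF⟩
  exact ⟨Module.Basis.mk (linearIndependent_xi hp hβ) (span_xi hβ).ge,
    fun k => Module.Basis.mk_apply _ _ k⟩
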